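/- \textbf{Theorem (oracle property).} Let $\Theta\subseteq\mathbb{R}^P$, $P=r+s$, and let $f(\cdot;\beta)$, $\beta\in\Theta$, be probability densities with respect to a measure $\mu$ on a measurable space, with laws $P_\beta$. Let $\beta_0=(\beta_{10},\beta_{20})\in\Theta$ be the true parameter, where all $r$ entries of $\beta_{10}$ are nonzero and $\beta_{20}=0\in\mathbb{R}^s$. Let $y_1,y_2,\dots$ be i.i.d. with law $P_{\beta_0}$, and assume: (1) the densities have a common support and $\beta\mapsto P_\beta$ is injective on $\Theta$; at $\beta_0$ the score $\nabla_\beta\log f(y;\beta_0)$ is integrable with $E_{\beta_0}[\nabla_\beta\log f(y;\beta_0)]=0$, and the Fisher information $I(\beta_0)=E_{\beta_0}[\nabla_\beta\log f\,(\nabla_\beta\log f)^{\top}]$ equals $-E_{\beta_0}[\nabla^2_\beta\log f(y;\beta_0)]$ (with integrable entries); (2) $I(\beta_0)$ is finite and positive definite; (3) there is an open set $\mathcal B\subseteq\Theta$ containing $\beta_0$ such that for almost all $y$ the map $\beta\mapsto f(y;\beta)$ is three times differentiable on $\mathcal B$ and $\left|\frac{\partial^3\log f(y;\beta)}{\partial\beta_i\partial\beta_j\partial\beta_k}\right|\le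 M_{ijk}(y)$ for all $\beta\in\mathcal B$ and all $i,j,k$, where $E_{\beta_0}[M_{ijk}(y)]<\infty$. Let $p_\lambda$ be a probability density on $(0,\infty)$ that is positive and decreasing there, and such that $\rho=-\log p_\lambda$ is twice differentiable on $(0,\infty)$ with $|\rho'|\le M_1$ and $|\rho''|\le M_2$ for some constants $M_1,M_2$. For $\tau,b\ge0$ put $g_\tau(b)=\min_{\lambda>0}\,[\tau\lambda b-\log\lambda+\rho(\lambda)]$. Let $\tau_0>0$, $\tau_n=n\tau_0$, and $$Q_n(\beta)=-\sum_{i=1}^n\log f(y_i;\beta)+\sum_{p=1}^P g_{\tau_n}(|\beta_p|),\qquad \beta\in\Theta .$$ Then there are measurable functions $\hat\beta^{(n)}=(\hat\beta_1^{(n)},\hat\beta_2^{(n)})\in\Theta$ of the data $(y_1,\dots,y_n)$ such that, as $n\to\infty$, the probability that $\hat\beta^{(n)}$ is a local minimizer of $Q_n$ over $\Theta$ tends to $1$, and (a) the probability that $\hat\beta_2^{(n)}=0$ tends to $1$; (b) $\sqrt n\,\bigl(\hat\beta_1^{(n)}-\beta_{10}\bigr)$ converges in distribution to $N\bigl(0,\,I_1(\beta_0)^{-1}\bigr)$,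 where $I_1(\beta_0)$ is the upper left $r\times r$ block of $I(\beta_0)$, that is, the Fisher information of the active variables (so $\hat\beta_1^{(n)}$ is asymptotically normal with covariance approximately $\frac1n I_1(\beta_0)^{-1}$). -/

import Mathlib

open MeasureTheory ProbabilityTheory Filter Topology

noncomputable section

namespace SBL

/-! ### Partial derivatives, density models, score and Fisher information -/

/-- The partial derivative of `g` in the `i`-th coordinate direction, at the point `b`. -/
def pd {m : ℕ} (i : Fin m) (g : EuclideanSpace ℝ (Fin m) → ℝ)
    (b : EuclideanSpace ℝ (Fin m)) : ℝ :=
  fderiv ℝ g b (EuclideanSpace.single i 1)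

/-- The probability law on the sample space with density `f β` with respect to `μ`. -/
def modelLaw {m : ℕ} {S : Type*} [MeasurableSpace S] (μ : Measure S)
    (f : EuclideanSpace ℝ (Fin m) → S → ℝ) (β : EuclideanSpace ℝ (Fin m)) : Measure S :=
  μ.withDensity fun y => ENNReal.ofReal (f β y)

/-- The log-density `log f(y; β)`, as a function of the parameter `β`. -/
def logDensity {m : ℕ} {S : Type*} (f : EuclideanSpace ℝ (Fin m) → S → ℝ) (y : S) :
    EuclideanSpace ℝ (Fin m) → ℝ :=
  fun b => Real.log (f b y)

/-- The `j`-th component of the score `∇_β log f(y; β)`. -/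
def score {m : ℕ} {S : Type*} (f : EuclideanSpace ℝ (Fin m) → S → ℝ)
    (β : EuclideanSpace ℝ (Fin m)) (j : Fin m) (y : S) : ℝ :=
  pd j (logDensity f y) β

/-- The Fisher information matrix `I(β) = E_β[∇ log f (∇ log f)ᵀ]`. -/
def fisherInfo {m : ℕ} {S : Type*} [MeasurableSpace S] (μ : Measure S)
    (f : EuclideanSpace ℝ (Fin m) → S → ℝ) (β : EuclideanSpace ℝ (Fin m)) :
    Matrix (Fin m) (Fin m) ℝ :=
  Matrix.of fun j k => ∫ y, score f β j y * score f β k y ∂(modelLaw μ f β)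

/-- The Fisher information of the first `r` (active) coordinates, the others being held fixed:
the upper left `r × r` block of the full information matrix. -/
def activeFisherInfo {r s : ℕ} {S : Type*} [MeasurableSpace S] (μ : Measure S)
    (f : EuclideanSpace ℝ (Fin (r + s)) → S → ℝ) (β : EuclideanSpace ℝ (Fin (r + s))) :
    Matrix (Fin r) (Fin r) ℝ :=
  (fisherInfo μ f β).submatrix (Fin.castAdd s) (Fin.castAdd s)

/-- The standard regularity conditions on a family `f(·; β)`, `β ∈ Θ`, of densities with respect
to `μ`, when `β₀` is the true parameter. -/
structure RegularModel {m : ℕ} {S : Type*} [MeasurableSpace S] (μ : Measure S)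
    (Θ : Set (EuclideanSpace ℝ (Fin m))) (f : EuclideanSpace ℝ (Fin m) → S → ℝ)
    (β₀ : EuclideanSpace ℝ (Fin m)) : Prop where
  measurable_density : ∀ β ∈ Θ, Measurable (f β)
  density_nonneg : ∀ β ∈ Θ, ∀ y, 0 ≤ f β y
  lintegral_density : ∀ β ∈ Θ, ∫⁻ y, ENNReal.ofReal (f β y) ∂μ = 1
  /-- The densities have a common support. -/
  common_support : ∀ β ∈ Θ, ∀ β' ∈ Θ, {y | 0 < f β y} = {y | 0 < f β' y}
  /-- Different parameters give different laws. -/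
  identifiable : Set.InjOn (modelLaw μ f) Θ
  /-- The score has expectation zero at the true parameter. -/
  integrable_score : ∀ j, Integrable (score f β₀ j) (modelLaw μ f β₀)
  integral_score : ∀ j, ∫ y, score f β₀ j y ∂(modelLaw μ f β₀) = 0
  /-- The information matrix at the true parameter is finite. -/
  integrable_score_mul : ∀ j k,
    Integrable (fun y => score f β₀ j y * score f β₀ k y) (modelLaw μ f β₀)
  /-- The information is minus the expected Hessian of the log-density. -/
  integrable_hessian : ∀ j k,
    Integrable (fun y => pd j (pd k (logDensity f y)) β₀) (modelLaw μ f β₀)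
  fisherInfo_eq : ∀ j k,
    fisherInfo μ f β₀ j k = -∫ y, pd j (pd k (logDensity f y)) β₀ ∂(modelLaw μ f β₀)
  /-- The information matrix at the true parameter is positive definite. -/
  fisherInfo_posDef : (fisherInfo μ f β₀).PosDef
  /-- On an open neighbourhood of the true parameter the density is, for almost every observation,
  three times (Fréchet) differentiable, and the third partial derivatives of the log-density
  are dominated there by functions with finite expectation. -/
  third_order : ∃ B : Set (EuclideanSpace ℝ (Fin m)), IsOpen B ∧ β₀ ∈ B ∧ B ⊆ Θ ∧
    (∀ᵐ y ∂μ, ∀ k : ℕ, k < 3 →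
      DifferentiableOn ℝ (iteratedFDeriv ℝ k fun b => f b y) B) ∧
    ∃ M : Fin m → Fin m → Fin m → S → ℝ,
      (∀ i j k, Integrable (M i j k) (modelLaw μ f β₀)) ∧
      ∀ᵐ y ∂μ, ∀ b ∈ B, ∀ i j k,
        |pd i (pd j (pd k (logDensity f y))) b| ≤ M i j k y

/-! ### The hyperprior and the profiled penalty -/

/-- `ρ(l) = -log p(l)` for the hyperprior density `p`. -/
def negLogPrior (p : ℝ → ℝ) (l : ℝ) : ℝ := -Real.log (p l)

/-- `p` is a (proper) probability density on `(0, ∞)`, positive and decreasing there, such that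
`ρ = -log p` is twice differentiable with bounded first and second derivatives. -/
structure RegularHyperprior (p : ℝ → ℝ) : Prop where
  pos : ∀ l, 0 < l → 0 < p l
  lintegral_eq_one : ∫⁻ l in Set.Ioi (0 : ℝ), ENNReal.ofReal (p l) = 1
  decreasing : AntitoneOn p (Set.Ioi 0)
  differentiable : DifferentiableOn ℝ (negLogPrior p) (Set.Ioi 0)
  differentiable_deriv : DifferentiableOn ℝ (deriv (negLogPrior p)) (Set.Ioi 0)
  deriv_bounded : ∃ M₁ : ℝ, ∀ l, 0 < l → |deriv (negLogPrior p) l| ≤ M₁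
  deriv_deriv_bounded : ∃ M₂ : ℝ, ∀ l, 0 < l → |deriv (deriv (negLogPrior p)) l| ≤ M₂

/-- The penalty `g_τ(b) = min_{l > 0} [τ l b - log l + ρ(l)]`. For `τ, b ≥ 0` and a hyperprior as in
`RegularHyperprior` the infimum is finite and attained. -/
def penalty (p : ℝ → ℝ) (τ b : ℝ) : ℝ :=
  ⨅ l : Set.Ioi (0 : ℝ), (τ * (l : ℝ) * b - Real.log (l : ℝ) + negLogPrior p (l : ℝ))

/-! ### The penalized likelihood -/

/-- The log-likelihood `L(β) = ∑ᵢ log f(yᵢ; β)` of the sample `y₁, …, yₙ`. -/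
def logLik {m : ℕ} {S : Type*} (f : EuclideanSpace ℝ (Fin m) → S → ℝ) {n : ℕ} (y : Fin n → S)
    (β : EuclideanSpace ℝ (Fin m)) : ℝ :=
  ∑ i, logDensity f (y i) β

/-- The penalized negative log-likelihood `Q(β) = -L(β) + ∑_p g_τ(|β_p|)`. -/
def penalizedLoss {m : ℕ} {S : Type*} (f : EuclideanSpace ℝ (Fin m) → S → ℝ) (p : ℝ → ℝ)
    (τ : ℝ) {n : ℕ} (y : Fin n → S) (β : EuclideanSpace ℝ (Fin m)) : ℝ :=
  -logLik f y β + ∑ q, penalty p τ |β q|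

/-- The active block `β₁` (the first `r` coordinates) of a parameter `β`. -/
def activeBlock {r s : ℕ} (β : EuclideanSpace ℝ (Fin (r + s))) : EuclideanSpace ℝ (Fin r) :=
  WithLp.toLp 2 fun j => β (Fin.castAdd s j)

/-- The inactive block `β₂` (the last `s` coordinates) of a parameter `β`. -/
def inactiveBlock {r s : ℕ} (β : EuclideanSpace ℝ (Fin (r + s))) : EuclideanSpace ℝ (Fin s) :=
  WithLp.toLp 2 fun k => β (Fin.natAdd r k)

end SBL

end

noncomputable section

namespace SBL

/-! ### Partial derivatives and second-order expansions -/

/-! The estimator is a minimizer of `Q_n` over the face `β₂ = 0` inside a closed ball of fixed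
radius `δ` about `β₀`, so (a) holds by construction. It remains to see that it is asymptotically
efficient in `β₁` and a local minimizer in all coordinates. Both rest on the penalty, which depends
on `τ b` alone, through `profile`.

Away from zero the penalty is harmless. Rescaling `λ` in the infimum shows that `profile` grows at
most logarithmically, so near `β₁₀` it is Lipschitz in the active coordinates with a constant free
of `τ` (`RegularHyperprior.abs_penalty_sub_le`). At deviation `x` along the face, `Q_n` is
therefore, up to a constant, `-√n ⟪S_n, x⟫ + (n/2) ⟪I₁ x, x⟫` with an error `o(n)‖x‖² + O(n)‖x‖³ +
O(‖x‖)`, where `S_n` is the active part of the normalized score. For small `δ`, positive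
definiteness forces a minimizer to have size `O(1/√n)`. At that scale the error vanishes, so `√n x`
is close to `I₁⁻¹ S_n` (`exists_eventually_argmin_close`), and the central limit theorem with
Slutsky's theorem gives (b).

At zero the penalty has a kink: its slope in each inactive direction is at least `n τ₀ a` with `a >
0` (`RegularHyperprior.exists_profile_zero_add_le`). On the ball the log-likelihood has Lipschitz
constant `O(√n) + n O(δ)`, which is smaller once `δ` is small and `n` large. Leaving the face then
raises the loss (`isLocalMin_penalizedLoss`).

`exists_radius_local_minimizer` carries this out for a fixed sample satisfying `RegularSample`. Such
samples have probability close to one by the law of large numbers and tightness of the score.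
`exists_measurable_argmin` makes the choice of minimizer measurable. -/

lemma norm_fderiv_le_of_abs_pd_le {m : ℕ} {g : EuclideanSpace ℝ (Fin m) → ℝ}
    {b : EuclideanSpace ℝ (Fin m)} {C : ℝ} (hC : 0 ≤ C) (h : ∀ i, |pd i g b| ≤ C) :
    ‖fderiv ℝ g b‖ ≤ m * C := by
  refine ContinuousLinearMap.opNorm_le_bound _ (by positivity) fun v => ?_
  have hv : v = ∑ i, v i • EuclideanSpace.single i (1 : ℝ) := by
    conv_lhs => rw [← (EuclideanSpace.basisFun (Fin m) ℝ).sum_repr v]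
    simp
  conv_lhs => rw [hv]
  rw [map_sum]
  calc ‖∑ i, fderiv ℝ g b (v i • EuclideanSpace.single i (1 : ℝ))‖
      ≤ ∑ i : Fin m, ‖v‖ * C := by
        refine norm_sum_le_of_le _ fun i _ => ?_
        rw [map_smul, norm_smul]
        exact mul_le_mul (PiLp.norm_apply_le v i) (h i) (norm_nonneg _) (norm_nonneg _)
    _ = m * C * ‖v‖ := by simp; ring

lemma abs_sub_le_of_abs_pd_le {m : ℕ} {g : EuclideanSpace ℝ (Fin m) → ℝ}
    {s : Set (EuclideanSpace ℝ (Fin m))} (hs : Convex ℝ s) {C : ℝ} (hC : 0 ≤ C)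
    (hd : ∀ b ∈ s, DifferentiableAt ℝ g b) (h : ∀ b ∈ s, ∀ i, |pd i g b| ≤ C)
    {x y : EuclideanSpace ℝ (Fin m)} (hx : x ∈ s) (hy : y ∈ s) :
    |g x - g y| ≤ m * C * ‖x - y‖ :=
  hs.norm_image_sub_le_of_norm_fderiv_le hd
    (fun b hb => norm_fderiv_le_of_abs_pd_le hC (h b hb)) hy hx

lemma HasFDerivAt.pd_eq {m : ℕ} {g : EuclideanSpace ℝ (Fin m) → ℝ}
    {g' : EuclideanSpace ℝ (Fin m) →L[ℝ] ℝ} {b : EuclideanSpace ℝ (Fin m)}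
    (h : HasFDerivAt g g' b) (i : Fin m) : pd i g b = g' (EuclideanSpace.single i 1) := by
  rw [pd, h.fderiv]

/-- The function is three times Fréchet differentiable at every point of `B`. -/
structure ThriceDifferentiableOn {E : Type*} [NormedAddCommGroup E] [NormedSpace ℝ E]
    (g : E → ℝ) (B : Set E) : Prop where
  first : ∀ b ∈ B, DifferentiableAt ℝ g b
  second : ∀ b ∈ B, DifferentiableAt ℝ (fderiv ℝ g) b
  third : ∀ b ∈ B, ∀ v w, DifferentiableAt ℝ (fun b => fderiv ℝ (fderiv ℝ g) b v w) b

lemma differentiableOn_fderiv_of_iteratedFDeriv {E F : Type*} [NormedAddCommGroup E]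
    [NormedSpace ℝ E] [NormedAddCommGroup F] [NormedSpace ℝ F] {g : E → F} {B : Set E}
    (h : DifferentiableOn ℝ (iteratedFDeriv ℝ 1 g) B) : DifferentiableOn ℝ (fderiv ℝ g) B := by
  have : fderiv ℝ g = (continuousMultilinearCurryFin1 ℝ E F) ∘ iteratedFDeriv ℝ 1 g := by
    funext x
    ext v
    simp
  rw [this]
  exact (continuousMultilinearCurryFin1 ℝ E F).toContinuousLinearEquiv.toContinuousLinearMap
    |>.differentiable.comp_differentiableOn h

lemma differentiableOn_fderiv_fderiv_of_iteratedFDeriv {E F : Type*} [NormedAddCommGroup E]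
    [NormedSpace ℝ E] [NormedAddCommGroup F] [NormedSpace ℝ F] {g : E → F} {B : Set E}
    (h : DifferentiableOn ℝ (iteratedFDeriv ℝ 2 g) B) (v w : E) :
    DifferentiableOn ℝ (fun b => fderiv ℝ (fderiv ℝ g) b v w) B := by
  have : (fun b => fderiv ℝ (fderiv ℝ g) b v w) = fun b =>
      ContinuousMultilinearMap.apply ℝ (fun _ : Fin 2 => E) F ![v, w]
        (iteratedFDeriv ℝ 2 g b) := by
    funext x
    simp [iteratedFDeriv_two_apply]
  rw [this]
  exact (ContinuousLinearMap.differentiable _).comp_differentiableOn h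

lemma thriceDifferentiableOn_of_iteratedFDeriv {E : Type*} [NormedAddCommGroup E]
    [NormedSpace ℝ E] {g : E → ℝ} {B : Set E} (hB : IsOpen B)
    (h : ∀ k : ℕ, k < 3 → DifferentiableOn ℝ (iteratedFDeriv ℝ k g) B) :
    ThriceDifferentiableOn g B where
  first b hb := by
    have h0 := h 0 (by norm_num)
    rw [iteratedFDeriv_zero_eq_comp] at h0
    exact ((LinearIsometryEquiv.comp_differentiableOn_iff
      (continuousMultilinearCurryFin0 ℝ E ℝ).symm).1 h0).differentiableAt (hB.mem_nhds hb)
  second b hb := (differentiableOn_fderiv_of_iteratedFDeriv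
    (h 1 (by norm_num))).differentiableAt (hB.mem_nhds hb)
  third b hb v w := (differentiableOn_fderiv_fderiv_of_iteratedFDeriv
    (h 2 (by norm_num)) v w).differentiableAt (hB.mem_nhds hb)

/-- Near each point the second derivative of `log g` is a polynomial in `g⁻¹` and the derivatives of
`g` of order at most two, all of which are differentiable once more. -/
lemma ThriceDifferentiableOn.log {E : Type*} [NormedAddCommGroup E]
    [NormedSpace ℝ E] {g : E → ℝ} {B : Set E} (hB : IsOpen B) (h : ThriceDifferentiableOn g B)
    (hpos : ∀ b ∈ B, 0 < g b) : ThriceDifferentiableOn (fun b => Real.log (g b)) B := by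
  have hinv : ∀ b ∈ B, DifferentiableAt ℝ (fun b => (g b)⁻¹) b := fun b hb =>
    (h.first b hb).inv (hpos b hb).ne'
  have h1 : ∀ b ∈ B, fderiv ℝ (fun b => Real.log (g b)) b = (g b)⁻¹ • fderiv ℝ g b :=
    fun b hb => ((h.first b hb).hasFDerivAt.log (hpos b hb).ne').fderiv
  have h1' : ∀ b ∈ B, fderiv ℝ (fun b => Real.log (g b)) =ᶠ[𝓝 b]
      fun b => (g b)⁻¹ • fderiv ℝ g b := fun b hb =>
    Filter.eventually_of_mem (hB.mem_nhds hb) h1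
  have hi : ∀ b ∈ B, HasFDerivAt (fun b => (g b)⁻¹) (-((g b)⁻¹ * (g b)⁻¹) • fderiv ℝ g b) b := by
    intro b hb
    have := (hasDerivAt_inv (hpos b hb).ne').comp_hasFDerivAt b (h.first b hb).hasFDerivAt
    rw [sq, mul_inv] at this
    exact this
  have h2 : ∀ v w, ∀ b ∈ B, fderiv ℝ (fderiv ℝ (fun b => Real.log (g b))) b v w =
      (g b)⁻¹ * fderiv ℝ (fderiv ℝ g) b v w -
        (g b)⁻¹ * (g b)⁻¹ * fderiv ℝ g b v * fderiv ℝ g b w := by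
    intro v w b hb
    rw [(h1' b hb).fderiv_eq, fderiv_fun_smul (hinv b hb) (h.second b hb), (hi b hb).fderiv]
    simp
    ring
  refine ⟨fun b hb => (h.first b hb).log (hpos b hb).ne', fun b hb => ?_, fun b hb v w => ?_⟩
  · exact ((hinv b hb).smul (h.second b hb)).congr_of_eventuallyEq (h1' b hb)
  · have hd1 : ∀ v, DifferentiableAt ℝ (fun b => fderiv ℝ g b v) b := fun v =>
      (h.second b hb).clm_apply (differentiableAt_const v)
    refine DifferentiableAt.congr_of_eventuallyEq ?_
      (Filter.eventually_of_mem (hB.mem_nhds hb) (h2 v w))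
    exact ((hinv b hb).mul (h.third b hb v w)).sub
      ((((hinv b hb).mul (hinv b hb)).mul (hd1 v)).mul (hd1 w))

/-! ### Lipschitz control of the second-order Taylor remainder -/

section Taylor

variable {m : ℕ} {g : EuclideanSpace ℝ (Fin m) → ℝ} {B : Set (EuclideanSpace ℝ (Fin m))}

lemma ThriceDifferentiableOn.differentiableAt_pd (h : ThriceDifferentiableOn g B) (k : Fin m)
    {b : EuclideanSpace ℝ (Fin m)} (hb : b ∈ B) : DifferentiableAt ℝ (pd k g) b :=
  (h.second b hb).clm_apply (differentiableAt_const _)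

lemma ThriceDifferentiableOn.pd_pd (h : ThriceDifferentiableOn g B) (j k : Fin m)
    {b : EuclideanSpace ℝ (Fin m)} (hb : b ∈ B) : pd j (pd k g) b =
      fderiv ℝ (fderiv ℝ g) b (EuclideanSpace.single j 1) (EuclideanSpace.single k 1) := by
  have := (h.second b hb).hasFDerivAt.clm_apply
    (hasFDerivAt_const (EuclideanSpace.single k (1 : ℝ)) b)
  refine (HasFDerivAt.pd_eq (g := pd k g) this j).trans ?_
  simp

lemma ThriceDifferentiableOn.differentiableAt_pd_pd (hB : IsOpen B)
    (h : ThriceDifferentiableOn g B) (j k : Fin m)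
    {b : EuclideanSpace ℝ (Fin m)} (hb : b ∈ B) : DifferentiableAt ℝ (pd j (pd k g)) b :=
  (h.third b hb _ _).congr_of_eventuallyEq
      (Filter.eventually_of_mem (hB.mem_nhds hb) fun _ hb' => h.pd_pd j k hb')

lemma ThriceDifferentiableOn.pd_comm (hB : IsOpen B)
    (h : ThriceDifferentiableOn g B) (j k : Fin m)
    {b : EuclideanSpace ℝ (Fin m)} (hb : b ∈ B) : pd j (pd k g) b = pd k (pd j g) b := by
  rw [h.pd_pd j k hb, h.pd_pd k j hb]
  exact second_derivative_symmetric_of_eventually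
    (Filter.eventually_of_mem (hB.mem_nhds hb) fun y hy => (h.first y hy).hasFDerivAt)
    (h.second b hb).hasFDerivAt _ _

/-- The remainder of the second-order Taylor expansion of `g` at `β₀`. -/
def taylorRemainder (g : EuclideanSpace ℝ (Fin m) → ℝ) (β₀ b : EuclideanSpace ℝ (Fin m)) : ℝ :=
  g b - g β₀ - ∑ k, pd k g β₀ * (b k - β₀ k)
    - 1 / 2 * ∑ j, ∑ k, pd j (pd k g) β₀ * ((b j - β₀ j) * (b k - β₀ k))

lemma hasFDerivAt_coord_sub (β₀ b : EuclideanSpace ℝ (Fin m)) (j : Fin m) :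
    HasFDerivAt (fun b : EuclideanSpace ℝ (Fin m) => b j - β₀ j)
      (EuclideanSpace.proj j : EuclideanSpace ℝ (Fin m) →L[ℝ] ℝ) b :=
  ((EuclideanSpace.proj j : EuclideanSpace ℝ (Fin m) →L[ℝ] ℝ).hasFDerivAt).sub_const _

lemma hasFDerivAt_linear_form (c : Fin m → ℝ) (β₀ b : EuclideanSpace ℝ (Fin m)) :
    HasFDerivAt (fun b : EuclideanSpace ℝ (Fin m) => ∑ j, c j * (b j - β₀ j))
      (∑ j, c j • (EuclideanSpace.proj j : EuclideanSpace ℝ (Fin m) →L[ℝ] ℝ)) b :=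
  HasFDerivAt.fun_sum fun j _ => (hasFDerivAt_coord_sub β₀ b j).const_mul (c j)

lemma hasFDerivAt_quadratic_form (c : Fin m → Fin m → ℝ) (β₀ b : EuclideanSpace ℝ (Fin m)) :
    HasFDerivAt (fun b : EuclideanSpace ℝ (Fin m) =>
        ∑ j, ∑ k, c j k * ((b j - β₀ j) * (b k - β₀ k)))
      (∑ j, ∑ k, c j k • ((b j - β₀ j) •
          (EuclideanSpace.proj k : EuclideanSpace ℝ (Fin m) →L[ℝ] ℝ) +
        (b k - β₀ k) • (EuclideanSpace.proj j : EuclideanSpace ℝ (Fin m) →L[ℝ] ℝ))) b :=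
  HasFDerivAt.fun_sum fun j _ => HasFDerivAt.fun_sum fun k _ =>
    ((hasFDerivAt_coord_sub β₀ b j).mul (hasFDerivAt_coord_sub β₀ b k)).const_mul (c j k)

lemma linear_form_apply_single (c : Fin m → ℝ) (i : Fin m) :
    (∑ j, c j • (EuclideanSpace.proj j : EuclideanSpace ℝ (Fin m) →L[ℝ] ℝ))
      (EuclideanSpace.single i 1) = c i := by
  simp

lemma quadratic_form_apply_single (c : Fin m → Fin m → ℝ) (d : Fin m → ℝ) (i : Fin m) :
    (∑ j, ∑ k, c j k • (d j • (EuclideanSpace.proj k : EuclideanSpace ℝ (Fin m) →L[ℝ] ℝ) +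
        d k • (EuclideanSpace.proj j : EuclideanSpace ℝ (Fin m) →L[ℝ] ℝ)))
      (EuclideanSpace.single i 1) = ∑ j, c j i * d j + ∑ k, c i k * d k := by
  simp [Finset.sum_add_distrib]

/-- The mean value inequality is applied to the Hessian, to the linearization error of the gradient,
and to the remainder itself. Each use costs a factor `m` (partial derivatives to operator norm) and
a distance: `ρ` twice, then `‖x - y‖`. The Lipschitz form serves to compare points off the face with
their projections; `y = β₀` and `ρ = ‖x - β₀‖` give back the cubic bound. -/
lemma abs_taylorRemainder_sub_le (hB : IsOpen B) (h : ThriceDifferentiableOn g B)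
    {β₀ : EuclideanSpace ℝ (Fin m)} {ρ K : ℝ} (hρ : 0 ≤ ρ) (hK : 0 ≤ K)
    (hsub : Metric.closedBall β₀ ρ ⊆ B)
    (h3 : ∀ b ∈ B, ∀ i j k, |pd i (pd j (pd k g)) b| ≤ K)
    {x y : EuclideanSpace ℝ (Fin m)} (hx : x ∈ Metric.closedBall β₀ ρ)
    (hy : y ∈ Metric.closedBall β₀ ρ) :
    |taylorRemainder g β₀ x - taylorRemainder g β₀ y| ≤ m ^ 3 * K * ρ ^ 2 * ‖x - y‖ := by
  set s := Metric.closedBall β₀ ρ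
  have hs : Convex ℝ s := convex_closedBall _ _
  have hβ : β₀ ∈ s := Metric.mem_closedBall_self hρ
  have hnorm : ∀ b ∈ s, ‖b - β₀‖ ≤ ρ := fun b hb => by rwa [← dist_eq_norm]
  have step2 : ∀ b ∈ s, ∀ j k, |pd j (pd k g) b - pd j (pd k g) β₀| ≤ m * K * ρ := by
    intro b hb j k
    refine (abs_sub_le_of_abs_pd_le hs hK
      (fun b hb => h.differentiableAt_pd_pd hB j k (hsub hb))
      (fun b hb i => h3 b (hsub hb) i j k) hb hβ).trans ?_
    exact mul_le_mul_of_nonneg_left (hnorm b hb) (by positivity)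
  have step1 : ∀ b ∈ s, ∀ k, |pd k g b - pd k g β₀
      - ∑ j, pd j (pd k g) β₀ * (b j - β₀ j)| ≤ m * (m * K * ρ) * ρ := by
    intro b hb k
    have hder : ∀ b ∈ s, HasFDerivAt
        (fun b => pd k g b - ∑ j, pd j (pd k g) β₀ * (b j - β₀ j)) _ b := fun b hb =>
      (h.differentiableAt_pd k (hsub hb)).hasFDerivAt.sub
        (hasFDerivAt_linear_form (fun j => pd j (pd k g) β₀) β₀ b)
    have := abs_sub_le_of_abs_pd_le hs (C := m * K * ρ) (by positivity)
      (fun b hb => (hder b hb).differentiableAt) (fun b hb i => ?_) hb hβ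
    · simp only [sub_self, mul_zero, Finset.sum_const_zero, sub_zero] at this
      rw [sub_right_comm]
      exact this.trans (mul_le_mul_of_nonneg_left (hnorm b hb) (by positivity))
    · rw [HasFDerivAt.pd_eq (hder b hb)]
      refine le_trans (le_of_eq ?_) (step2 b hb i k)
      congr 1
      simp [pd]
  have hder : ∀ b ∈ s, HasFDerivAt (taylorRemainder g β₀) _ b := fun b hb =>
    (((h.first b (hsub hb)).hasFDerivAt.sub_const (g β₀)).sub
      (hasFDerivAt_linear_form (fun j => pd j g β₀) β₀ b)).sub
      ((hasFDerivAt_quadratic_form (fun j k => pd j (pd k g) β₀) β₀ b).const_mul (1 / 2))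
  have := abs_sub_le_of_abs_pd_le hs (C := m * (m * K * ρ) * ρ) (by positivity)
      (fun b hb => (hder b hb).differentiableAt) (fun b hb i => ?_) hx hy
  · refine this.trans (le_of_eq ?_)
    ring
  · rw [HasFDerivAt.pd_eq (hder b hb)]
    refine le_trans (le_of_eq ?_) (step1 b hb i)
    congr 1
    -- The derivative of the quadratic form hits both slots; symmetry of the Hessian merges the two
    -- sums and cancels the factor `1 / 2`.
    have hsymm : ∀ j, pd i (pd j g) β₀ = pd j (pd i g) β₀ := fun j =>
      h.pd_comm hB i j (hsub hβ)
    rw [sub_apply, sub_apply, smul_apply, linear_form_apply_single,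
      quadratic_form_apply_single]
    simp_rw [smul_eq_mul, hsymm]
    simp only [pd]
    ring

end Taylor

/-! ### The profiled penalty -/

/-- The profiled penalty as a function of the single argument `t = τ b`. -/
def profile (p : ℝ → ℝ) (t : ℝ) : ℝ :=
  ⨅ l : Set.Ioi (0 : ℝ), (t * (l : ℝ) - Real.log (l : ℝ) + negLogPrior p (l : ℝ))

lemma penalty_eq_profile (p : ℝ → ℝ) (τ b : ℝ) : penalty p τ b = profile p (τ * b) := by
  simp only [penalty, profile, mul_right_comm]

section

variable {p : ℝ → ℝ}

/-- A decreasing density is at least `p l` on `(0, l]`, and its total mass is 1. Hence `-log l +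
ρ(l) = -log (l p(l)) ≥ 0`, which keeps the infimum in `profile` finite. -/
lemma RegularHyperprior.mul_le_one (hp : RegularHyperprior p) {l : ℝ} (hl : 0 < l) :
    l * p l ≤ 1 := by
  have h : ENNReal.ofReal (l * p l) ≤ 1 := by
    rw [← hp.lintegral_eq_one]
    calc ENNReal.ofReal (l * p l) = ∫⁻ _ in Set.Ioc 0 l, ENNReal.ofReal (p l) := by
          rw [setLIntegral_const, Real.volume_Ioc, sub_zero, ENNReal.ofReal_mul hl.le, mul_comm]
      _ ≤ ∫⁻ x in Set.Ioc 0 l, ENNReal.ofReal (p x) :=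
          setLIntegral_mono' measurableSet_Ioc fun x hx =>
            ENNReal.ofReal_le_ofReal (hp.decreasing hx.1 hl hx.2)
      _ ≤ _ := lintegral_mono_set Set.Ioc_subset_Ioi_self
  simpa using h

lemma RegularHyperprior.objective_nonneg (hp : RegularHyperprior p) {t l : ℝ} (ht : 0 ≤ t)
    (hl : 0 < l) : 0 ≤ t * l - Real.log l + negLogPrior p l := by
  have h := Real.log_nonpos (mul_pos hl (hp.pos l hl)).le (hp.mul_le_one hl)
  rw [Real.log_mul hl.ne' (hp.pos l hl).ne'] at h
  have := mul_nonneg ht hl.le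
  unfold negLogPrior
  linarith

lemma RegularHyperprior.profile_le (hp : RegularHyperprior p) {t l : ℝ} (ht : 0 ≤ t)
    (hl : 0 < l) : profile p t ≤ t * l - Real.log l + negLogPrior p l :=
  ciInf_le ⟨0, by rintro _ ⟨l, rfl⟩; exact hp.objective_nonneg ht l.2⟩ (⟨l, hl⟩ : Set.Ioi (0 : ℝ))

lemma le_profile {t a : ℝ} (h : ∀ l, 0 < l → a ≤ t * l - Real.log l + negLogPrior p l) :
    a ≤ profile p t :=
  haveI : Nonempty (Set.Ioi (0 : ℝ)) := ⟨⟨1, Set.mem_Ioi.2 one_pos⟩⟩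
  le_ciInf fun l => h l l.2

lemma RegularHyperprior.profile_mono (hp : RegularHyperprior p) {t t' : ℝ} (ht : 0 ≤ t)
    (h : t ≤ t') : profile p t ≤ profile p t' :=
  le_profile fun l hl => (hp.profile_le ht hl).trans (by gcongr)

/-- The trial point `l t / t'` for `t'` reproduces the linear term `t l` and does not increase `ρ`,
since `p` is decreasing. Only the logarithm costs anything. -/
lemma RegularHyperprior.profile_le_add_log (hp : RegularHyperprior p) {t t' : ℝ} (ht : 0 < t)
    (h : t ≤ t') : profile p t' ≤ profile p t + (Real.log t' - Real.log t) := by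
  rw [← sub_le_iff_le_add]
  refine le_profile fun l hl => ?_
  have ht' : 0 < t' := ht.trans_le h
  have hl' : 0 < l * t / t' := by positivity
  have hle : l * t / t' ≤ l := by
    rw [div_le_iff₀ ht']
    gcongr
  have h1 := hp.profile_le ht'.le hl'
  have h2 : negLogPrior p (l * t / t') ≤ negLogPrior p l :=
    neg_le_neg (Real.log_le_log (hp.pos l hl) (hp.decreasing hl' hl hle))
  rw [Real.log_div (by positivity) ht'.ne', Real.log_mul hl.ne' ht.ne',
    mul_div_cancel₀ _ ht'.ne'] at h1
  linarith

/-- The factor `τ` cancels in `log (τ b) - log (τ b')`. This uniformity in `τ` is why `τ_n = n τ₀`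
does not disturb the limit law of the active coordinates. -/
lemma RegularHyperprior.abs_penalty_sub_le (hp : RegularHyperprior p) {τ b b' : ℝ} (hτ : 0 ≤ τ)
    (hb : 0 < b) (hb' : 0 < b') :
    |penalty p τ b - penalty p τ b'| ≤ |Real.log b - Real.log b'| := by
  wlog hle : b' ≤ b generalizing b b'
  · rw [abs_sub_comm, abs_sub_comm (Real.log b)]
    exact this hb' hb (not_le.1 hle).le
  rw [penalty_eq_profile, penalty_eq_profile]
  rcases hτ.eq_or_lt with rfl | hτ
  · simp
  have h1 := hp.profile_mono (mul_nonneg hτ.le hb'.le) (mul_le_mul_of_nonneg_left hle hτ.le)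
  have h2 := hp.profile_le_add_log (mul_pos hτ hb') (mul_le_mul_of_nonneg_left hle hτ.le)
  have h3 := Real.log_le_log hb' hle
  rw [Real.log_mul hτ.ne' hb.ne', Real.log_mul hτ.ne' hb'.ne'] at h2
  rw [abs_of_nonneg (by linarith), abs_of_nonneg (by linarith)]
  linarith

/-- The profiled penalty has a kink of positive slope at the origin. -/
lemma RegularHyperprior.exists_profile_zero_add_le (hp : RegularHyperprior p) :
    ∃ a > 0, ∀ t, 0 ≤ t → t * a ≤ 1 → profile p 0 + t * a ≤ profile p t := by
  obtain ⟨M, hM⟩ := hp.deriv_bounded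
  have hlip : ∀ l, 0 < l → l ≤ 1 → negLogPrior p 1 - M ≤ negLogPrior p l := by
    intro l hl hl1
    have h := (convex_Ioi (0 : ℝ)).norm_image_sub_le_of_norm_deriv_le (f := negLogPrior p)
      (fun x hx => (hp.differentiable x hx).differentiableAt (Ioi_mem_nhds hx))
      (fun x hx => hM x hx) (Set.mem_Ioi.2 hl) (Set.mem_Ioi.2 one_pos)
    have hM0 : 0 ≤ M := (abs_nonneg _).trans (hM 1 one_pos)
    rw [Real.norm_eq_abs, Real.norm_eq_abs, abs_of_nonneg (by linarith : 0 ≤ 1 - l)] at h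
    have := (le_abs_self _).trans h
    nlinarith
  -- For `l` below both 1 and `exp (-A)`, the term `-log l` and the bound `ρ(l) ≥ ρ(1) - M` push the
  -- objective up to `profile p 0 + 1`, and `t a ≤ 1`. For larger `l` the linear term `t l` supplies
  -- `t a`.
  set A := profile p 0 + 1 - negLogPrior p 1 + M
  refine ⟨min 1 (Real.exp (-A)), by positivity, fun t ht hta => le_profile fun l hl => ?_⟩
  rcases le_or_gt (min 1 (Real.exp (-A))) l with hcase | hcase
  · have h1 := hp.profile_le le_rfl hl
    have h2 := mul_le_mul_of_nonneg_left hcase ht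
    linarith
  · have h1 := hlip l hl (hcase.le.trans (min_le_left _ _))
    have h2 : Real.log l ≤ -A :=
      (Real.log_le_iff_le_exp hl).2 (hcase.le.trans (min_le_right _ _))
    have h3 := mul_nonneg ht hl.le
    simp only [A] at h2
    linarith

end

/-! ### Measurable selection of a minimizer -/

/-- The least minimizer is selected. It is at most `c` exactly when the minimum over `C ∩ (-∞, c]`
does not exceed the values on `C`; by continuity, countable dense subsets decide this. -/
lemma exists_measurable_argmin_of_subset_real {X : Type*} [MeasurableSpace X] {C : Set ℝ}
    (hC : IsCompact C) (hne : C.Nonempty) (q : X → C → ℝ) (hq : ∀ x, Continuous (q x))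
    (hm : ∀ c, Measurable fun x => q x c) :
    ∃ a : X → C, Measurable a ∧ ∀ x c, q x (a x) ≤ q x c := by
  have : CompactSpace C := isCompact_iff_compactSpace.1 hC
  have : Nonempty C := hne.to_subtype
  have hmin : ∀ (x : X), ∃ c : C, (∀ c', q x c ≤ q x c') ∧
      ∀ c', (∀ c'', q x c' ≤ q x c'') → c ≤ c' := by
    intro x
    obtain ⟨c₀, -, hc₀⟩ := isCompact_univ.exists_isMinOn Set.univ_nonempty (hq x).continuousOn
    have hcl : IsClosed {c : C | ∀ c', q x c ≤ q x c'} := by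
      simp only [Set.ofPred_forall]
      exact isClosed_iInter fun c' => isClosed_le (hq x) continuous_const
    obtain ⟨c, hc, hle⟩ := hcl.isCompact.exists_isMinOn
      (f := id) ⟨c₀, fun c' => hc₀ (Set.mem_univ c')⟩ continuousOn_id
    exact ⟨c, hc, fun c' hc' => hle hc'⟩
  choose a ha hle using hmin
  refine ⟨a, ?_, ha⟩
  suffices h : Measurable fun x => (a x : ℝ) from h.subtype_mk (h := fun x => (a x).2)
  refine measurable_of_Iic fun c => ?_
  set T : Set C := {z | (z : ℝ) ≤ c}
  have hT : IsClosed T := isClosed_le continuous_subtype_val continuous_const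
  obtain ⟨D, hDc, hDd⟩ := TopologicalSpace.exists_countable_dense C
  obtain ⟨D', hDc', hDd'⟩ := TopologicalSpace.exists_countable_dense T
  -- membership: for each `k`, some point of `D'` is within `1 / (k + 1)` of all values on `D`
  have key : (fun x => (a x : ℝ)) ⁻¹' Set.Iic c = ⋂ k : ℕ, ⋃ d' ∈ D', ⋂ d ∈ D,
      {x | q x (d' : C) ≤ q x d + 1 / ((k : ℝ) + 1)} := by
    ext x
    simp only [Set.mem_preimage, Set.mem_Iic, Set.mem_iInter, Set.mem_iUnion, Set.mem_ofPred_eq,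
      exists_prop]
    have hcont : Continuous fun z : T => q x z := (hq x).comp continuous_subtype_val
    constructor
    · intro hax k
      have hopen : IsOpen {z : T | q x z < q x (a x) + 1 / ((k : ℝ) + 1)} :=
        isOpen_lt hcont continuous_const
      obtain ⟨d', hd', hd'D⟩ := hDd'.inter_open_nonempty _ hopen
        ⟨⟨a x, hax⟩, by
          simp only [Set.mem_ofPred_eq]
          linarith [Nat.one_div_pos_of_nat (α := ℝ) (n := k)]⟩
      refine ⟨d', hd'D, fun d _ => ?_⟩
      have := ha x d
      simp only [Set.mem_ofPred_eq] at hd'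
      linarith
    · intro h
      have : CompactSpace T := isCompact_iff_compactSpace.1 hT.isCompact
      have : Nonempty T := ⟨(h 0).choose⟩
      obtain ⟨z, -, hz⟩ := isCompact_univ.exists_isMinOn Set.univ_nonempty hcont.continuousOn
      refine le_trans (Subtype.coe_le_coe.2 (hle x z fun c'' => ?_)) z.2
      refine hDd.induction (P := fun c'' => q x z ≤ q x c'') (fun d hd => ?_)
        (isClosed_le continuous_const (hq x)) c''
      refine le_of_forall_pos_le_add fun ε hε => ?_
      obtain ⟨k, hk⟩ := exists_nat_one_div_lt hε
      obtain ⟨d', -, hd'⟩ := h k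
      have h1 : q x z ≤ q x d' := hz (Set.mem_univ d')
      have h2 := hd' d hd
      linarith
  rw [key]
  refine MeasurableSet.iInter fun k => MeasurableSet.biUnion hDc' fun d' _ =>
    MeasurableSet.biInter hDc fun d _ => ?_
  exact measurableSet_le (hm _) ((hm _).add_const _)

/-- A function on `X × K`, `K` compact metric, that is continuous in the second variable and
measurable in the first, has a measurable choice of minimizers. -/
lemma exists_measurable_argmin {X K : Type*} [MeasurableSpace X] [MetricSpace K] [CompactSpace K]
    [Nonempty K] [MeasurableSpace K] [BorelSpace K] (q : X → K → ℝ) (hq : ∀ x, Continuous (q x))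
    (hm : ∀ c, Measurable fun x => q x c) :
    ∃ a : X → K, Measurable a ∧ ∀ x c, q x (a x) ≤ q x c := by
  -- A nonempty compact metric space is a continuous image of the Cantor set, so the problem is
  -- pulled back to a compact subset of `ℝ`.
  obtain ⟨π, hπ, hsurj⟩ := exists_nat_bool_continuous_surjective_of_compact K
  have hπ' : Continuous (π ∘ cantorSetHomeomorphNatToBool) :=
    hπ.comp cantorSetHomeomorphNatToBool.continuous
  obtain ⟨a, ha, hmin⟩ := exists_measurable_argmin_of_subset_real isCompact_cantorSet
    ⟨0, zero_mem_cantorSet⟩ (fun x c => q x (π (cantorSetHomeomorphNatToBool c)))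
    (fun x => (hq x).comp hπ') (fun c => hm _)
  refine ⟨fun x => π (cantorSetHomeomorphNatToBool (a x)), hπ'.measurable.comp ha, fun x c => ?_⟩
  obtain ⟨z, rfl⟩ := hsurj c
  simpa using hmin x (cantorSetHomeomorphNatToBool.symm z)

/-! ### Minimizers of perturbed quadratic functions -/

/-- For `φ(x) = ⟪T x, x⟫ / 2 - ⟪T u, x⟫` the difference `φ(v) - φ(u)` equals `⟪T (v - u), v - u⟫ /
2`. Since `a` and `b` are `φ(v)` and `φ(u)` up to `e`, `a ≤ b` bounds it by `2 e`. -/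
lemma norm_sub_sq_le_of_quadratic_perturbation {F : Type*} [NormedAddCommGroup F]
    [InnerProductSpace ℝ F] {T : F →ₗ[ℝ] F} (hT : T.IsSymmetric) {c e : ℝ}
    (hc : ∀ v, c * ‖v‖ ^ 2 ≤ inner ℝ (T v) v) {u v : F} {a b : ℝ} (hab : a ≤ b)
    (ha : |a + inner ℝ (T u) v - 1 / 2 * inner ℝ (T v) v| ≤ e)
    (hb : |b + inner ℝ (T u) u - 1 / 2 * inner ℝ (T u) u| ≤ e) :
    c * ‖v - u‖ ^ 2 ≤ 4 * e := by
  have h1 := hc (v - u)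
  have h2 : (inner ℝ (T v) u : ℝ) = inner ℝ (T u) v := by
    rw [hT v u, real_inner_comm]
  rw [map_sub, inner_sub_left, inner_sub_right, inner_sub_right, h2] at h1
  have h3 := abs_le.1 ha
  have h4 := abs_le.1 hb
  linarith [h3.1, h4.2]

/-- A minimizer over a ball of a function that is close to the quadratic function
`x ↦ -√n ⟪T u, x⟫ + (n / 2) ⟪T x, x⟫` is close to the minimizer `u / √n` of the latter. -/
lemma exists_eventually_argmin_close {F : Type*} [NormedAddCommGroup F]
    [InnerProductSpace ℝ F] {T : F →ₗ[ℝ] F} (hT : T.IsSymmetric) {c m C δ K ε : ℝ}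
    (hc0 : 0 < c) (hc : ∀ v, c * ‖v‖ ^ 2 ≤ inner ℝ (T v) v) (hm : 0 ≤ m) (hC : 0 ≤ C)
    (hδ : 0 < δ) (hmδ : m * δ ≤ c / 8) (hK : 0 ≤ K) (hε : 0 < ε) :
    ∃ η > 0, ∀ᶠ n : ℕ in atTop, ∀ (u d : F) (q : F → ℝ), ‖T u‖ ≤ K →
      (∀ x, ‖x‖ ≤ δ → |q x - q 0 + √n * inner ℝ (T u) x - n / 2 * inner ℝ (T x) x| ≤
        n * η * ‖x‖ ^ 2 + n * m * ‖x‖ ^ 3 + C * ‖x‖) →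
      ‖d‖ ≤ δ → (∀ x, ‖x‖ ≤ δ → q d ≤ q x) → ‖√(n : ℝ) • d - u‖ ≤ ε ∧ ‖d‖ < δ := by
  -- `K₁` will bound `√n ‖d‖`. Of the curvature `c / 2`, the quadratic and cubic errors take `c / 8`
  -- each and `c / 4` is left.
  set K₁ := 4 / c * (K + C)
  have hK₁ : 0 ≤ K₁ := by positivity
  -- The second entry makes the quadratic error at most `c ε² / 8` where `√n ‖x‖ ≤ K₁`; the `+ 1`
  -- covers `K₁ = 0`.
  set η := min (c / 8) (c * ε ^ 2 / (8 * (K₁ ^ 2 + 1)))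
  have hη : 0 < η := lt_min (by positivity) (by positivity)
  have hη1 : η ≤ c / 8 := min_le_left _ _
  have hη2 : η * K₁ ^ 2 ≤ c * ε ^ 2 / 8 := by
    have h1 : η * (8 * (K₁ ^ 2 + 1)) ≤ c * ε ^ 2 :=
      (le_div_iff₀ (by positivity)).1 (min_le_right _ _)
    nlinarith
  have hsqrt : Tendsto (fun n : ℕ => √(n : ℝ)) atTop atTop :=
    Real.tendsto_sqrt_atTop.comp tendsto_natCast_atTop_atTop
  refine ⟨η, hη, ?_⟩
  filter_upwards [hsqrt.eventually_ge_atTop 1,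
    hsqrt.eventually_ge_atTop ((m * K₁ ^ 3 + C * K₁) / (c * ε ^ 2 / 8)),
    hsqrt.eventually_gt_atTop (K₁ / δ)] with n hn1 hn2 hn3 u d q hTu hq hd hmin
  set w := √(n : ℝ)
  have hw0 : 0 < w := one_pos.trans_le hn1
  have hww : (n : ℝ) = w ^ 2 := (Real.sq_sqrt n.cast_nonneg).symm
  rw [hww] at hq
  rw [div_le_iff₀ (by positivity)] at hn2
  rw [div_lt_iff₀ hδ] at hn3
  -- the minimizer is of order `1 / √n`
  have hwd : w * ‖d‖ ≤ K₁ := by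
    have h1 := hq d hd
    have h2 : q d ≤ q 0 := hmin 0 (by simpa using hδ.le)
    have h3 := (abs_le.1 h1).1
    have h4 : inner ℝ (T u) d ≤ K * ‖d‖ :=
      (real_inner_le_norm _ _).trans (mul_le_mul_of_nonneg_right hTu (norm_nonneg _))
    have h5 := hc d
    have h6 : m * ‖d‖ ^ 3 ≤ c / 8 * ‖d‖ ^ 2 := by
      have : m * ‖d‖ ≤ c / 8 := (mul_le_mul_of_nonneg_left hd hm).trans hmδ
      nlinarith [sq_nonneg ‖d‖]
    have h7 : η * ‖d‖ ^ 2 ≤ c / 8 * ‖d‖ ^ 2 := by gcongr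
    have h8 : C * ‖d‖ ≤ w * (C * ‖d‖) := le_mul_of_one_le_left (by positivity) hn1
    have h9 : w ^ 2 * (c / 4 * ‖d‖ ^ 2) ≤ w * ((K + C) * ‖d‖) := by
      have e1 := mul_le_mul_of_nonneg_left h4 hw0.le
      have e2 := mul_le_mul_of_nonneg_left h5 (sq_nonneg w)
      have e3 := mul_le_mul_of_nonneg_left h6 (sq_nonneg w)
      have e4 := mul_le_mul_of_nonneg_left h7 (sq_nonneg w)
      nlinarith
    rcases (norm_nonneg d).eq_or_lt with h0 | h0
    · rw [← h0, mul_zero]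
      exact hK₁
    · have : (w * ‖d‖) * (w * ‖d‖ * (c / 4)) ≤ (w * ‖d‖) * (K + C) := by
        convert h9 using 1 <;> ring
      have := le_of_mul_le_mul_left this (by positivity)
      simp only [K₁]
      rw [div_mul_eq_mul_div, le_div_iff₀ hc0]
      linarith
  have hu : ‖u‖ ≤ K₁ := by
    have h1 := hc u
    have h2 : inner ℝ (T u) u ≤ K * ‖u‖ :=
      (real_inner_le_norm _ _).trans (mul_le_mul_of_nonneg_right hTu (norm_nonneg _))
    rcases (norm_nonneg u).eq_or_lt with h0 | h0
    · rwa [← h0]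
    · have h3 : ‖u‖ * (c * ‖u‖) ≤ ‖u‖ * K := by nlinarith
      have h4 := le_of_mul_le_mul_left h3 h0
      simp only [K₁]
      rw [div_mul_eq_mul_div, le_div_iff₀ hc0]
      nlinarith
  have hsmall : ∀ y : F, w * ‖y‖ ≤ K₁ → ‖y‖ < δ := fun y hy => by
    have : w * ‖y‖ < w * δ := hy.trans_lt hn3
    exact lt_of_mul_lt_mul_left this hw0.le
  refine ⟨?_, hsmall d hwd⟩
  -- Both `d` and `u / √n` lie in this range. An error of `c ε² / 4` is what the quadratic
  -- comparison turns into distance `ε`.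
  have herr : ∀ y : F, w * ‖y‖ ≤ K₁ →
      |q y - q 0 + inner ℝ (T u) (w • y) - 1 / 2 * inner ℝ (T (w • y)) (w • y)|
        ≤ c * ε ^ 2 / 4 := by
    intro y hy
    have h1 := hq y (hsmall y hy).le
    rw [map_smul, inner_smul_right, inner_smul_right, inner_smul_left]
    simp only [conj_trivial]
    have h2 : 1 / 2 * (w * (w * inner ℝ (T y) y)) = w ^ 2 / 2 * inner ℝ (T y) y := by ring
    rw [h2]
    refine h1.trans ?_
    have hy0 : 0 ≤ w * ‖y‖ := by positivity
    have e1 : w ^ 2 * η * ‖y‖ ^ 2 ≤ c * ε ^ 2 / 8 := by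
      calc w ^ 2 * η * ‖y‖ ^ 2 = η * (w * ‖y‖) ^ 2 := by ring
        _ ≤ η * K₁ ^ 2 := by gcongr
        _ ≤ _ := hη2
    have e2 : w ^ 2 * m * ‖y‖ ^ 3 + C * ‖y‖ ≤ c * ε ^ 2 / 8 := by
      refine le_of_mul_le_mul_left ?_ hw0
      calc w * (w ^ 2 * m * ‖y‖ ^ 3 + C * ‖y‖) = m * (w * ‖y‖) ^ 3 + C * (w * ‖y‖) := by ring
        _ ≤ m * K₁ ^ 3 + C * K₁ := by gcongr
        _ ≤ _ := hn2
    linarith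
  have hx : w * ‖w⁻¹ • u‖ ≤ K₁ := by
    rw [norm_smul, Real.norm_of_nonneg (by positivity), mul_inv_cancel_left₀ hw0.ne']
    exact hu
  have hfin := norm_sub_sq_le_of_quadratic_perturbation hT hc
    (a := q d - q 0) (b := q (w⁻¹ • u) - q 0) (u := u) (v := w • d)
    (by linarith [hmin _ (hsmall _ hx).le]) (herr d hwd)
    (by simpa only [smul_inv_smul₀ hw0.ne'] using herr _ hx)
  have : ‖w • d - u‖ ^ 2 ≤ ε ^ 2 := by
    refine le_of_mul_le_mul_left ?_ hc0
    linarith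
  exact (sq_le_sq₀ (norm_nonneg _) hε.le).1 this

/-! ### The active coordinates -/

section Blocks

variable {r s : ℕ}

/-- The parameter with active block `v` and inactive block `0`. -/
def embedActive (v : EuclideanSpace ℝ (Fin r)) : EuclideanSpace ℝ (Fin (r + s)) :=
  WithLp.toLp 2 (Fin.append v 0)

@[simp] lemma embedActive_castAdd (v : EuclideanSpace ℝ (Fin r)) (j : Fin r) :
    (embedActive v : EuclideanSpace ℝ (Fin (r + s))) (Fin.castAdd s j) = v j := by
  simp [embedActive]

@[simp] lemma embedActive_natAdd (v : EuclideanSpace ℝ (Fin r)) (k : Fin s) :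
    (embedActive v : EuclideanSpace ℝ (Fin (r + s))) (Fin.natAdd r k) = 0 := by
  simp [embedActive]

@[simp] lemma activeBlock_apply (b : EuclideanSpace ℝ (Fin (r + s))) (j : Fin r) :
    activeBlock b j = b (Fin.castAdd s j) := rfl

@[simp] lemma activeBlock_embedActive (v : EuclideanSpace ℝ (Fin r)) :
    activeBlock (embedActive v : EuclideanSpace ℝ (Fin (r + s))) = v := by
  ext j
  simp

@[simp] lemma inactiveBlock_embedActive (v : EuclideanSpace ℝ (Fin r)) :
    inactiveBlock (embedActive v : EuclideanSpace ℝ (Fin (r + s))) = 0 := by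
  ext k
  simp [inactiveBlock]

lemma embedActive_activeBlock {b : EuclideanSpace ℝ (Fin (r + s))} (h : inactiveBlock b = 0) :
    embedActive (activeBlock b) = b := by
  ext q
  refine Fin.addCases (fun j => by simp) (fun k => ?_) q
  have : inactiveBlock b k = 0 := by rw [h]; rfl
  rw [embedActive_natAdd]
  exact this.symm

lemma embedActive_sub (v w : EuclideanSpace ℝ (Fin r)) :
    (embedActive (v - w) : EuclideanSpace ℝ (Fin (r + s))) = embedActive v - embedActive w := by
  ext q
  refine Fin.addCases (fun j => by simp) (fun k => by simp) q

lemma norm_embedActive (v : EuclideanSpace ℝ (Fin r)) :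
    ‖(embedActive v : EuclideanSpace ℝ (Fin (r + s)))‖ = ‖v‖ := by
  rw [← sq_eq_sq₀ (norm_nonneg _) (norm_nonneg _), EuclideanSpace.real_norm_sq_eq,
    EuclideanSpace.real_norm_sq_eq, Fin.sum_univ_add]
  simp

lemma continuous_embedActive :
    Continuous (embedActive : EuclideanSpace ℝ (Fin r) → EuclideanSpace ℝ (Fin (r + s))) := by
  refine LipschitzWith.continuous (K := 1) (LipschitzWith.of_dist_le_mul fun v w => ?_)
  rw [dist_eq_norm, dist_eq_norm, ← embedActive_sub, norm_embedActive]
  simp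

lemma norm_activeBlock_le (b : EuclideanSpace ℝ (Fin (r + s))) : ‖activeBlock b‖ ≤ ‖b‖ := by
  rw [← sq_le_sq₀ (norm_nonneg _) (norm_nonneg _), EuclideanSpace.real_norm_sq_eq,
    EuclideanSpace.real_norm_sq_eq, Fin.sum_univ_add]
  simpa using Finset.sum_nonneg fun k _ => sq_nonneg (b (Fin.natAdd r k))

lemma activeBlock_sub (b b' : EuclideanSpace ℝ (Fin (r + s))) :
    activeBlock (b - b') = activeBlock b - activeBlock b' := rfl

lemma norm_le_sum_abs {m : ℕ} (v : EuclideanSpace ℝ (Fin m)) : ‖v‖ ≤ ∑ i, |v i| := by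
  have hv : v = ∑ i, v i • EuclideanSpace.single i (1 : ℝ) := by
    conv_lhs => rw [← (EuclideanSpace.basisFun (Fin m) ℝ).sum_repr v]
    simp
  conv_lhs => rw [hv]
  refine norm_sum_le_of_le _ fun i _ => ?_
  simp [norm_smul]

lemma norm_sub_embedActive_activeBlock_le (b : EuclideanSpace ℝ (Fin (r + s))) :
    ‖b - embedActive (activeBlock b)‖ ≤ ∑ k, |b (Fin.natAdd r k)| := by
  refine (norm_le_sum_abs _).trans (le_of_eq ?_)
  rw [Fin.sum_univ_add]
  simp

lemma inner_embedActive (a : EuclideanSpace ℝ (Fin (r + s))) (v : EuclideanSpace ℝ (Fin r)) :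
    (inner ℝ a (embedActive v) : ℝ) = inner ℝ (activeBlock a) v := by
  simp [PiLp.inner_apply, Fin.sum_univ_add]

end Blocks

/-! ### Quadratic forms -/

section QuadForm

variable {m : ℕ}

/-- The quadratic form `d ↦ dᵀ A d`. -/
def quadForm (A : Matrix (Fin m) (Fin m) ℝ) (d : EuclideanSpace ℝ (Fin m)) : ℝ :=
  ∑ j, ∑ k, A j k * (d j * d k)

lemma abs_sum_sum_le {F : Fin m → Fin m → ℝ} {C : ℝ} (h : ∀ j k, |F j k| ≤ C) :
    |∑ j, ∑ k, F j k| ≤ m ^ 2 * C := by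
  calc |∑ j, ∑ k, F j k| ≤ ∑ _j : Fin m, ∑ _k : Fin m, C :=
        (Finset.abs_sum_le_sum_abs _ _).trans (Finset.sum_le_sum fun j _ =>
          (Finset.abs_sum_le_sum_abs _ _).trans (Finset.sum_le_sum fun k _ => h j k))
    _ = m ^ 2 * C := by simp; ring

lemma abs_apply_le_norm (d : EuclideanSpace ℝ (Fin m)) (j : Fin m) : |d j| ≤ ‖d‖ :=
  PiLp.norm_apply_le d j

lemma abs_quadForm_sub_le {A J : Matrix (Fin m) (Fin m) ℝ} {η : ℝ}
    (h : ∀ j k, |A j k - J j k| ≤ η) (d : EuclideanSpace ℝ (Fin m)) :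
    |quadForm A d - quadForm J d| ≤ m ^ 2 * (η * ‖d‖ ^ 2) := by
  simp only [quadForm, ← Finset.sum_sub_distrib, ← sub_mul]
  refine abs_sum_sum_le fun j k => ?_
  rw [abs_mul, abs_mul, sq]
  exact mul_le_mul (h j k) (mul_le_mul (abs_apply_le_norm d j) (abs_apply_le_norm d k)
    (abs_nonneg _) (norm_nonneg _)) (by positivity) ((abs_nonneg _).trans (h j k))

lemma abs_quadForm_sub_quadForm_le {A : Matrix (Fin m) (Fin m) ℝ} {a δ : ℝ} (hδ : 0 ≤ δ)
    (h : ∀ j k, |A j k| ≤ a) {d d' : EuclideanSpace ℝ (Fin m)} (hd : ‖d‖ ≤ δ) (hd' : ‖d'‖ ≤ δ) :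
    |quadForm A d - quadForm A d'| ≤ m ^ 2 * (a * (2 * δ * ‖d - d'‖)) := by
  simp only [quadForm, ← Finset.sum_sub_distrib, ← mul_sub]
  refine abs_sum_sum_le fun j k => ?_
  rw [abs_mul]
  refine mul_le_mul (h j k) ?_ (abs_nonneg _) ((abs_nonneg _).trans (h j k))
  have e : d j * d k - d' j * d' k = (d - d') j * d k + d' j * (d - d') k := by
    simp only [PiLp.sub_apply]
    ring
  rw [e]
  refine (abs_add_le _ _).trans ?_
  rw [abs_mul, abs_mul]
  have h1 := mul_le_mul (abs_apply_le_norm (d - d') j) ((abs_apply_le_norm d k).trans hd)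
    (abs_nonneg _) (norm_nonneg _)
  have h2 := mul_le_mul ((abs_apply_le_norm d' j).trans hd') (abs_apply_le_norm (d - d') k)
    (abs_nonneg _) hδ
  linarith

lemma quadForm_eq_inner (A : Matrix (Fin m) (Fin m) ℝ) (d : EuclideanSpace ℝ (Fin m)) :
    quadForm A d = inner ℝ (Matrix.toEuclideanLin A d) d := by
  simp only [quadForm, PiLp.inner_apply, Matrix.toLpLin_apply, Matrix.mulVec, dotProduct,
    RCLike.inner_apply, conj_trivial, Finset.mul_sum]
  refine Finset.sum_congr rfl fun j _ => Finset.sum_congr rfl fun k _ => ?_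
  ring

lemma quadForm_embedActive {r s : ℕ} (A : Matrix (Fin (r + s)) (Fin (r + s)) ℝ)
    (v : EuclideanSpace ℝ (Fin r)) :
    quadForm A (embedActive v) = quadForm (A.submatrix (Fin.castAdd s) (Fin.castAdd s)) v := by
  simp [quadForm, Fin.sum_univ_add]

/-- Compactness of the unit sphere and homogeneity; an empty sphere leaves only the zero vector. -/
lemma exists_pos_mul_norm_sq_le_quadForm {A : Matrix (Fin m) (Fin m) ℝ} (hA : A.PosDef) :
    ∃ c > 0, ∀ d, c * ‖d‖ ^ 2 ≤ quadForm A d := by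
  have hcont : Continuous (quadForm A) := by
    unfold quadForm
    fun_prop
  have hpos : ∀ d ≠ 0, 0 < quadForm A d := by
    intro d hd
    have h := hA.dotProduct_mulVec_pos (x := d.ofLp) (by simpa using hd)
    refine h.trans_eq ?_
    simp only [quadForm, dotProduct, Matrix.mulVec, Finset.mul_sum]
    refine Finset.sum_congr rfl fun j _ => Finset.sum_congr rfl fun k _ => ?_
    simp
    ring
  rcases (Metric.sphere (0 : EuclideanSpace ℝ (Fin m)) 1).eq_empty_or_nonempty with he | hne
  · refine ⟨1, one_pos, fun d => ?_⟩
    by_cases hd : d = 0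
    · simp [hd, quadForm]
    · have : (‖d‖⁻¹ • d) ∈ Metric.sphere (0 : EuclideanSpace ℝ (Fin m)) 1 := by
        simp [norm_smul, hd]
      simp [he] at this
  · obtain ⟨x, hx, hmin⟩ := (isCompact_sphere (0 : EuclideanSpace ℝ (Fin m)) 1).exists_isMinOn
      hne hcont.continuousOn
    have hx0 : x ≠ 0 := by
      rintro rfl
      simp at hx
    refine ⟨quadForm A x, hpos x hx0, fun d => ?_⟩
    by_cases hd : d = 0
    · simp [hd, quadForm]
    · have hmem : (‖d‖⁻¹ • d) ∈ Metric.sphere (0 : EuclideanSpace ℝ (Fin m)) 1 := by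
        simp [norm_smul, hd]
      have h1 : quadForm A x ≤ quadForm A (‖d‖⁻¹ • d) := hmin hmem
      have h2 : quadForm A (‖d‖⁻¹ • d) = (‖d‖ ^ 2)⁻¹ * quadForm A d := by
        simp only [quadForm, Finset.mul_sum]
        refine Finset.sum_congr rfl fun j _ => Finset.sum_congr rfl fun k _ => ?_
        simp
        ring
      have hd2 : 0 < ‖d‖ ^ 2 := by positivity
      rw [h2, inv_mul_eq_div, le_div_iff₀ hd2] at h1
      exact h1

end QuadForm

/-! ### Expansion of the log-likelihood -/

section Likelihood

variable {m : ℕ} {S : Type*}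

/-- The score as a vector. -/
def scoreVec (f : EuclideanSpace ℝ (Fin m) → S → ℝ) (β : EuclideanSpace ℝ (Fin m)) (y : S) :
    EuclideanSpace ℝ (Fin m) :=
  WithLp.toLp 2 fun k => score f β k y

/-- The normalized score `n^{-1/2} ∑ᵢ ∇ log f(yᵢ; β)` of a sample. -/
def sampleScore (f : EuclideanSpace ℝ (Fin m) → S → ℝ) (β : EuclideanSpace ℝ (Fin m)) {n : ℕ}
    (y : Fin n → S) : EuclideanSpace ℝ (Fin m) :=
  (√(n : ℝ))⁻¹ • ∑ i, scoreVec f β (y i)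

/-- The Hessian of the log-density of a single observation. -/
def hessian (f : EuclideanSpace ℝ (Fin m) → S → ℝ) (β : EuclideanSpace ℝ (Fin m)) (y : S) :
    Matrix (Fin m) (Fin m) ℝ :=
  Matrix.of fun j k => pd j (pd k (logDensity f y)) β

/-- The average over a sample. -/
def sampleMean (M : S → ℝ) {n : ℕ} (y : Fin n → S) : ℝ := (∑ i, M (y i)) / n

/-- The observed information, normalized by the sample size. -/
def sampleInfo (f : EuclideanSpace ℝ (Fin m) → S → ℝ) (β : EuclideanSpace ℝ (Fin m)) {n : ℕ}
    (y : Fin n → S) : Matrix (Fin m) (Fin m) ℝ :=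
  Matrix.of fun j k => sampleMean (fun z => -hessian f β z j k) y

/-- The log-density at the observation `y` is regular on `B`, with third derivatives bounded
by `M y`. -/
structure RegularObservation (f : EuclideanSpace ℝ (Fin m) → S → ℝ)
    (B : Set (EuclideanSpace ℝ (Fin m))) (M : S → ℝ) (y : S) : Prop where
  thrice : ThriceDifferentiableOn (logDensity f y) B
  nonneg : 0 ≤ M y
  bound : ∀ b ∈ B, ∀ i j k, |pd i (pd j (pd k (logDensity f y))) b| ≤ M y

variable {f : EuclideanSpace ℝ (Fin m) → S → ℝ} {B : Set (EuclideanSpace ℝ (Fin m))} {M : S → ℝ}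

lemma logDensity_eq (f : EuclideanSpace ℝ (Fin m) → S → ℝ) (y : S)
    (β₀ b : EuclideanSpace ℝ (Fin m)) :
    logDensity f y b = logDensity f y β₀ + inner ℝ (scoreVec f β₀ y) (b - β₀)
      + 1 / 2 * quadForm (hessian f β₀ y) (b - β₀) + taylorRemainder (logDensity f y) β₀ b := by
  simp only [taylorRemainder, quadForm, hessian, scoreVec, score, PiLp.inner_apply,
    RCLike.inner_apply, conj_trivial, PiLp.sub_apply, Matrix.of_apply]
  have : ∑ k, pd k (logDensity f y) β₀ * (b k - β₀ k)
      = ∑ k, (b k - β₀ k) * pd k (logDensity f y) β₀ :=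
    Finset.sum_congr rfl fun k _ => mul_comm _ _
  rw [this]
  ring

lemma mul_quadForm_sampleInfo {n : ℕ} (hn : n ≠ 0) (y : Fin n → S)
    (β₀ d : EuclideanSpace ℝ (Fin m)) :
    n * quadForm (sampleInfo f β₀ y) d = -∑ i, quadForm (hessian f β₀ (y i)) d := by
  have hn' : (n : ℝ) ≠ 0 := Nat.cast_ne_zero.2 hn
  simp only [quadForm, sampleInfo, sampleMean, Matrix.of_apply]
  have hcomm : ∑ i, ∑ j, ∑ k, hessian f β₀ (y i) j k * (d j * d k)
      = ∑ j, ∑ k, ∑ i, hessian f β₀ (y i) j k * (d j * d k) := by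
    rw [Finset.sum_comm]
    exact Finset.sum_congr rfl fun j _ => Finset.sum_comm
  rw [hcomm, Finset.mul_sum, ← Finset.sum_neg_distrib]
  refine Finset.sum_congr rfl fun j _ => ?_
  rw [Finset.mul_sum, ← Finset.sum_neg_distrib]
  refine Finset.sum_congr rfl fun k _ => ?_
  rw [← mul_assoc, mul_div_cancel₀ _ hn', Finset.sum_mul, ← Finset.sum_neg_distrib]
  exact Finset.sum_congr rfl fun i _ => by ring

lemma sqrt_mul_inner_sampleScore {n : ℕ} (hn : n ≠ 0) (y : Fin n → S)
    (β₀ d : EuclideanSpace ℝ (Fin m)) :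
    √(n : ℝ) * inner ℝ (sampleScore f β₀ y) d = ∑ i, inner ℝ (scoreVec f β₀ (y i)) d := by
  have hn' : √(n : ℝ) ≠ 0 := by positivity
  rw [sampleScore, real_inner_smul_left, mul_inv_cancel_left₀ hn', sum_inner]

/-- The second-order expansion of the log-likelihood at `β₀`. -/
lemma abs_logLik_sub_le {n : ℕ} (hn : n ≠ 0) {y : Fin n → S}
    (hy : ∀ i, RegularObservation f B M (y i)) (hB : IsOpen B) {β₀ : EuclideanSpace ℝ (Fin m)}
    {ρ : ℝ} (hρ : 0 ≤ ρ) (hsub : Metric.closedBall β₀ ρ ⊆ B) {b b' : EuclideanSpace ℝ (Fin m)}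
    (hb : ‖b - β₀‖ ≤ ρ) (hb' : ‖b' - β₀‖ ≤ ρ) :
    |logLik f y b - logLik f y b' - √(n : ℝ) * inner ℝ (sampleScore f β₀ y) (b - b')
        + n / 2 * (quadForm (sampleInfo f β₀ y) (b - β₀)
          - quadForm (sampleInfo f β₀ y) (b' - β₀))| ≤
      n * (m ^ 3 * sampleMean M y * ρ ^ 2 * ‖b - b'‖) := by
  have e1 : logLik f y b - logLik f y b' - √(n : ℝ) * inner ℝ (sampleScore f β₀ y) (b - b')
        + n / 2 * (quadForm (sampleInfo f β₀ y) (b - β₀)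
          - quadForm (sampleInfo f β₀ y) (b' - β₀))
      = ∑ i, (taylorRemainder (logDensity f (y i)) β₀ b
        - taylorRemainder (logDensity f (y i)) β₀ b') := by
    have h1 := mul_quadForm_sampleInfo (f := f) hn y β₀ (b - β₀)
    have h2 := mul_quadForm_sampleInfo (f := f) hn y β₀ (b' - β₀)
    have h3 := sqrt_mul_inner_sampleScore (f := f) hn y β₀ (b - β₀)
    have h4 := sqrt_mul_inner_sampleScore (f := f) hn y β₀ (b' - β₀)
    have h5 : b - b' = (b - β₀) - (b' - β₀) := by abel
    rw [h5, inner_sub_right, mul_sub, h3, h4, mul_sub, div_mul_eq_mul_div, div_mul_eq_mul_div,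
      h1, h2]
    simp only [logLik]
    rw [Finset.sum_congr rfl fun i _ => logDensity_eq f (y i) β₀ b,
      Finset.sum_congr rfl fun i _ => logDensity_eq f (y i) β₀ b']
    simp only [Finset.sum_add_distrib, Finset.sum_sub_distrib, ← Finset.mul_sum]
    ring
  have hn' : (n : ℝ) ≠ 0 := Nat.cast_ne_zero.2 hn
  rw [e1]
  calc |∑ i, (taylorRemainder (logDensity f (y i)) β₀ b
        - taylorRemainder (logDensity f (y i)) β₀ b')|
      ≤ ∑ i, m ^ 3 * M (y i) * ρ ^ 2 * ‖b - b'‖ :=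
        (Finset.abs_sum_le_sum_abs _ _).trans (Finset.sum_le_sum fun i _ =>
          abs_taylorRemainder_sub_le hB (hy i).thrice hρ (hy i).nonneg hsub (hy i).bound
            (by rwa [mem_closedBall_iff_norm]) (by rwa [mem_closedBall_iff_norm]))
    _ = n * (m ^ 3 * sampleMean M y * ρ ^ 2 * ‖b - b'‖) := by
        rw [← Finset.sum_mul, ← Finset.sum_mul, ← Finset.mul_sum, sampleMean]
        field_simp

end Likelihood

/-! ### The penalty near the true parameter -/

lemma abs_log_sub_log_le {κ b b' : ℝ} (hκ : 0 < κ) (hb : κ ≤ b) (hb' : κ ≤ b') :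
    |Real.log b - Real.log b'| ≤ |b - b'| / κ := by
  wlog hle : b' ≤ b generalizing b b'
  · rw [abs_sub_comm, abs_sub_comm b]
    exact this hb' hb (not_le.1 hle).le
  have hb0 := hκ.trans_le hb
  have hb0' := hκ.trans_le hb'
  rw [abs_of_nonneg (sub_nonneg.2 (Real.log_le_log hb0' hle)), abs_of_nonneg (sub_nonneg.2 hle),
    ← Real.log_div hb0.ne' hb0'.ne']
  calc Real.log (b / b') ≤ b / b' - 1 := Real.log_le_sub_one_of_pos (by positivity)
    _ = (b - b') / b' := by field_simp
    _ ≤ (b - b') / κ := div_le_div_of_nonneg_left (sub_nonneg.2 hle) hκ hb'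

lemma half_le_abs_add {α a x : ℝ} (ha : α ≤ |a|) (hx : |x| ≤ α / 2) : α / 2 ≤ |a + x| := by
  have := abs_sub_abs_le_abs_sub a (-x)
  rw [abs_neg, sub_neg_eq_add] at this
  linarith

lemma RegularHyperprior.abs_penalty_abs_add_sub_le {p : ℝ → ℝ} (hp : RegularHyperprior p)
    {τ α a x : ℝ} (hτ : 0 ≤ τ) (hα : 0 < α) (ha : α ≤ |a|) (hx : |x| ≤ α / 2) :
    |penalty p τ (|a + x|) - penalty p τ (|a|)| ≤ 2 / α * |x| := by
  have h1 := half_le_abs_add ha hx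
  have hα2 : 0 < α / 2 := by positivity
  refine (hp.abs_penalty_sub_le hτ (hα2.trans_le h1) (hα.trans_le ha)).trans ?_
  refine (abs_log_sub_log_le hα2 h1 (by linarith)).trans ?_
  have h2 : |(|a + x| - |a|)| ≤ |x| := by
    simpa using abs_abs_sub_abs_le_abs_sub (a + x) a
  rw [div_div_eq_mul_div, div_mul_eq_mul_div, mul_comm]
  gcongr

lemma RegularHyperprior.continuousAt_penalty {p : ℝ → ℝ} (hp : RegularHyperprior p)
    {τ b : ℝ} (hτ : 0 ≤ τ) (hb : 0 < b) : ContinuousAt (penalty p τ) b := by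
  rw [ContinuousAt, tendsto_iff_norm_sub_tendsto_zero]
  have hlog : Tendsto (fun b' => |Real.log b' - Real.log b|) (𝓝 b) (𝓝 0) := by
    have h1 := ((Real.continuousAt_log hb.ne').sub_const (Real.log b)).abs
    simpa [ContinuousAt] using h1
  refine squeeze_zero' (Eventually.of_forall fun _ => norm_nonneg _) ?_ hlog
  filter_upwards [Ioi_mem_nhds hb] with b' hb'
  exact hp.abs_penalty_sub_le hτ hb' hb

section Active

variable {r s : ℕ} {S : Type*}

/-- The penalty of a parameter vector. -/
def totalPenalty {m : ℕ} (p : ℝ → ℝ) (τ : ℝ) (b : EuclideanSpace ℝ (Fin m)) : ℝ :=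
  ∑ q, penalty p τ |b q|

lemma totalPenalty_embedActive (p : ℝ → ℝ) (τ : ℝ) (v : EuclideanSpace ℝ (Fin r)) :
    totalPenalty p τ (embedActive v : EuclideanSpace ℝ (Fin (r + s))) =
      ∑ j, penalty p τ |v j| + s * profile p 0 := by
  simp [totalPenalty, Fin.sum_univ_add, penalty_eq_profile p τ 0]

lemma abs_totalPenalty_sub_le {p : ℝ → ℝ} (hp : RegularHyperprior p) {τ α : ℝ} (hτ : 0 ≤ τ)
    (hα : 0 < α) {a x : EuclideanSpace ℝ (Fin r)} (ha : ∀ j, α ≤ |a j|) (hx : ‖x‖ ≤ α / 2) :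
    |totalPenalty p τ (embedActive (a + x) : EuclideanSpace ℝ (Fin (r + s)))
        - totalPenalty p τ (embedActive a : EuclideanSpace ℝ (Fin (r + s)))|
      ≤ r * (2 / α) * ‖x‖ := by
  rw [totalPenalty_embedActive, totalPenalty_embedActive, add_sub_add_right_eq_sub,
    ← Finset.sum_sub_distrib]
  calc _ ≤ ∑ _j : Fin r, 2 / α * ‖x‖ :=
        (Finset.abs_sum_le_sum_abs _ _).trans (Finset.sum_le_sum fun j _ =>
          (hp.abs_penalty_abs_add_sub_le hτ hα (ha j)
            ((abs_apply_le_norm x j).trans hx)).trans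
          (mul_le_mul_of_nonneg_left (abs_apply_le_norm x j) (by positivity)))
    _ = r * (2 / α) * ‖x‖ := by simp; ring

lemma continuousAt_totalPenalty_embedActive {p : ℝ → ℝ} (hp : RegularHyperprior p) {τ : ℝ}
    (hτ : 0 ≤ τ) {v : EuclideanSpace ℝ (Fin r)} (hv : ∀ j, v j ≠ 0) :
    ContinuousAt (fun v : EuclideanSpace ℝ (Fin r) =>
      totalPenalty p τ (embedActive v : EuclideanSpace ℝ (Fin (r + s)))) v := by
  simp only [totalPenalty_embedActive]
  refine ContinuousAt.add ?_ continuousAt_const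
  refine tendsto_finsetSum _ fun j _ => ?_
  exact ContinuousAt.comp (f := fun v : EuclideanSpace ℝ (Fin r) => |v j|)
    (hp.continuousAt_penalty hτ (abs_pos.2 (hv j))) (by fun_prop)

lemma penalizedLoss_eq {m : ℕ} (f : EuclideanSpace ℝ (Fin m) → S → ℝ) (p : ℝ → ℝ) (τ : ℝ) {n : ℕ}
    (y : Fin n → S) (b : EuclideanSpace ℝ (Fin m)) :
    penalizedLoss f p τ y b = -logLik f y b + totalPenalty p τ b := rfl

/-- The penalty saved by setting the inactive coordinates to zero. The range allowed by `hb` shrinks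
as `τ` grows, which does not matter for local minimality. -/
lemma le_totalPenalty_sub {p : ℝ → ℝ} {τ a : ℝ} (hτ : 0 ≤ τ)
    (ha : ∀ t, 0 ≤ t → t * a ≤ 1 → profile p 0 + t * a ≤ profile p t)
    {b : EuclideanSpace ℝ (Fin (r + s))} (hb : ∀ k, τ * |b (Fin.natAdd r k)| * a ≤ 1) :
    τ * a * ∑ k, |b (Fin.natAdd r k)| ≤
      totalPenalty p τ b
        - totalPenalty p τ (embedActive (activeBlock b) : EuclideanSpace ℝ (Fin (r + s))) := by
  have : totalPenalty p τ b
        - totalPenalty p τ (embedActive (activeBlock b) : EuclideanSpace ℝ (Fin (r + s)))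
      = ∑ k : Fin s, (profile p (τ * |b (Fin.natAdd r k)|) - profile p 0) := by
    rw [totalPenalty_embedActive, totalPenalty, Fin.sum_univ_add]
    simp [penalty_eq_profile]
  rw [this, Finset.mul_sum]
  refine Finset.sum_le_sum fun k _ => ?_
  have := ha _ (mul_nonneg hτ (abs_nonneg _)) (hb k)
  linarith

/-- A minimizer over the active coordinates in the interior of a ball is a local minimizer over
all coordinates when the slope of the penalty at the origin dominates the slope of the
log-likelihood. -/
lemma isLocalMin_penalizedLoss {f : EuclideanSpace ℝ (Fin (r + s)) → S → ℝ} {p : ℝ → ℝ}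
    {β₀ : EuclideanSpace ℝ (Fin (r + s))} (h_inactive : inactiveBlock β₀ = 0)
    {τ a δ : ℝ} (hτ : 0 ≤ τ) (ha0 : 0 < a)
    (ha : ∀ t, 0 ≤ t → t * a ≤ 1 → profile p 0 + t * a ≤ profile p t) {n : ℕ} {y : Fin n → S}
    (hlip : ∀ b b', ‖b - β₀‖ ≤ δ → ‖b' - β₀‖ ≤ δ →
      |logLik f y b - logLik f y b'| ≤ τ * a * ‖b - b'‖)
    {x : EuclideanSpace ℝ (Fin r)} (hx : ‖x‖ < δ)
    (hmin : ∀ x', ‖x'‖ ≤ δ → penalizedLoss f p τ y (embedActive (activeBlock β₀ + x)) ≤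
      penalizedLoss f p τ y (embedActive (activeBlock β₀ + x'))) :
    IsLocalMin (penalizedLoss f p τ y) (embedActive (activeBlock β₀ + x)) := by
  have hβ : embedActive (activeBlock β₀) = β₀ := embedActive_activeBlock h_inactive
  have hnorm : ∀ v : EuclideanSpace ℝ (Fin r), ‖embedActive (activeBlock β₀ + v) - β₀‖ = ‖v‖ := by
    intro v
    conv_lhs => rw [← hβ]
    rw [activeBlock_embedActive, ← embedActive_sub, add_sub_cancel_left, norm_embedActive]
  have h1 : ∀ᶠ b in 𝓝 (embedActive (activeBlock β₀ + x) : EuclideanSpace ℝ (Fin (r + s))),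
      ‖b - β₀‖ < δ :=
    ContinuousAt.eventually_lt (by fun_prop) continuousAt_const (by rwa [hnorm])
  have h2 : ∀ᶠ b in 𝓝 (embedActive (activeBlock β₀ + x) : EuclideanSpace ℝ (Fin (r + s))),
      ∀ k : Fin s, τ * |b (Fin.natAdd r k)| * a < 1 :=
    eventually_all.2 fun k => ContinuousAt.eventually_lt (by fun_prop) continuousAt_const
      (by simp)
  -- `b` is compared with its projection to the face, and the projection with the minimizer on the
  -- face.
  filter_upwards [h1, h2] with b hb1 hb2
  have hact : ‖activeBlock b - activeBlock β₀‖ ≤ δ := by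
    rw [← activeBlock_sub]
    exact (norm_activeBlock_le _).trans hb1.le
  have h3 := hmin _ hact
  have h4 := hlip b (embedActive (activeBlock b)) hb1.le (by
    have := hnorm (activeBlock b - activeBlock β₀)
    rw [add_sub_cancel] at this
    rwa [this])
  rw [add_sub_cancel] at h3
  refine h3.trans ?_
  have h5 := le_totalPenalty_sub hτ ha fun k => (hb2 k).le
  have h6 := mul_le_mul_of_nonneg_left (norm_sub_embedActive_activeBlock_le b)
    (mul_nonneg hτ ha0.le)
  rw [penalizedLoss_eq, penalizedLoss_eq]
  have h7 := (le_abs_self _).trans h4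
  linarith

end Active

/-! ### Local minimizers for regular samples -/

section Deterministic

variable {r s : ℕ} {S : Type*} {f : EuclideanSpace ℝ (Fin (r + s)) → S → ℝ}
  {B : Set (EuclideanSpace ℝ (Fin (r + s)))} {M : S → ℝ} {β₀ : EuclideanSpace ℝ (Fin (r + s))}
  {J : Matrix (Fin (r + s)) (Fin (r + s)) ℝ} {p : ℝ → ℝ}

/-- The sample consists of regular observations, the normalized score is bounded by `K`, the
observed information is within `η` of `J` and the average of `M` is at most `m₀`. -/
structure RegularSample (f : EuclideanSpace ℝ (Fin (r + s)) → S → ℝ)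
    (B : Set (EuclideanSpace ℝ (Fin (r + s)))) (M : S → ℝ) (β₀ : EuclideanSpace ℝ (Fin (r + s)))
    (J : Matrix (Fin (r + s)) (Fin (r + s)) ℝ) (m₀ K η : ℝ) {n : ℕ} (y : Fin n → S) : Prop where
  regular : ∀ i, RegularObservation f B M (y i)
  score_le : ‖sampleScore f β₀ y‖ ≤ K
  info_close : ∀ j k, |sampleInfo f β₀ y j k - J j k| ≤ η
  mean_le : sampleMean M y ≤ m₀

/-- Apart from the score term of order `√n`, the slope per observation vanishes with `δ`, so a small
radius lets the kink dominate. -/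
lemma RegularSample.abs_logLik_sub_le_mul {m₀ K η A δ : ℝ} {n : ℕ} {y : Fin n → S}
    (h : RegularSample f B M β₀ J m₀ K η y) (hn : n ≠ 0) (hB : IsOpen B) (hδ : 0 ≤ δ)
    (hsub : Metric.closedBall β₀ δ ⊆ B) (hA : ∀ j k, |J j k| ≤ A)
    {b b' : EuclideanSpace ℝ (Fin (r + s))} (hb : ‖b - β₀‖ ≤ δ) (hb' : ‖b' - β₀‖ ≤ δ) :
    |logLik f y b - logLik f y b'| ≤ (√(n : ℝ) * K + n * (((r + s : ℕ) : ℝ) ^ 2 * (A + η) * δ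
      + ((r + s : ℕ) : ℝ) ^ 3 * m₀ * δ ^ 2)) * ‖b - b'‖ := by
  have h1 := abs_logLik_sub_le hn h.regular hB hδ hsub hb hb'
  have h2 : |√(n : ℝ) * inner ℝ (sampleScore f β₀ y) (b - b')| ≤ √(n : ℝ) * (K * ‖b - b'‖) := by
    rw [abs_mul, abs_of_nonneg (Real.sqrt_nonneg _)]
    gcongr
    exact (abs_real_inner_le_norm _ _).trans
      (mul_le_mul_of_nonneg_right h.score_le (norm_nonneg _))
  have hA' : ∀ j k, |sampleInfo f β₀ y j k| ≤ A + η := by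
    intro j k
    have := abs_add_le (J j k) (sampleInfo f β₀ y j k - J j k)
    rw [add_sub_cancel] at this
    linarith [hA j k, h.info_close j k]
  have h3 := abs_quadForm_sub_quadForm_le hδ hA' hb hb'
  rw [sub_sub_sub_cancel_right] at h3
  have h4 := mul_le_mul_of_nonneg_left h3 (by positivity : (0 : ℝ) ≤ n / 2)
  have h5 : n * (((r + s : ℕ) : ℝ) ^ 3 * sampleMean M y * δ ^ 2 * ‖b - b'‖) ≤
      n * (((r + s : ℕ) : ℝ) ^ 3 * m₀ * δ ^ 2 * ‖b - b'‖) := by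
    gcongr
    exact h.mean_le
  set X := logLik f y b - logLik f y b'
  set Z := √(n : ℝ) * inner ℝ (sampleScore f β₀ y) (b - b')
  set W := quadForm (sampleInfo f β₀ y) (b - β₀) - quadForm (sampleInfo f β₀ y) (b' - β₀)
  have h6 : |n / 2 * W| = n / 2 * |W| := by rw [abs_mul, abs_of_nonneg (by positivity)]
  have h7 : |X| ≤ |X - Z + n / 2 * W| + |Z| + |n / 2 * W| := by
    have e : X = (X - Z + n / 2 * W) + Z - n / 2 * W := by ring
    calc |X| = |(X - Z + n / 2 * W) + Z - n / 2 * W| := by rw [← e]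
      _ ≤ |(X - Z + n / 2 * W) + Z| + |n / 2 * W| := abs_sub _ _
      _ ≤ _ := by gcongr; exact abs_add_le _ _
  rw [h6] at h7
  refine h7.trans ((add_le_add (add_le_add (h1.trans h5) h2) h4).trans (le_of_eq ?_))
  ring

/-- The likelihood expansion is used with radius `‖x‖` in place of `δ`, which makes its remainder
cubic in `x`. -/
lemma RegularSample.abs_penalizedLoss_sub_quadratic_le {m₀ K η α τ δ : ℝ} {n : ℕ} {y : Fin n → S}
    (h : RegularSample f B M β₀ J m₀ K η y) (hn : n ≠ 0) (hB : IsOpen B)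
    (hsub : Metric.closedBall β₀ δ ⊆ B) (hp : RegularHyperprior p) (hτ : 0 ≤ τ) (hα : 0 < α)
    (h_inactive : inactiveBlock β₀ = 0) (ha : ∀ j, α ≤ |activeBlock β₀ j|)
    (hδα : δ ≤ α / 2) {x : EuclideanSpace ℝ (Fin r)} (hx : ‖x‖ ≤ δ) :
    |penalizedLoss f p τ y (embedActive (activeBlock β₀ + x))
        - penalizedLoss f p τ y (embedActive (activeBlock β₀ + 0))
        + √(n : ℝ) * inner ℝ (activeBlock (sampleScore f β₀ y)) x
        - n / 2 * quadForm (J.submatrix (Fin.castAdd s) (Fin.castAdd s)) x| ≤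
      n * (((r + s : ℕ) : ℝ) ^ 2 * η) * ‖x‖ ^ 2 + n * (((r + s : ℕ) : ℝ) ^ 3 * m₀) * ‖x‖ ^ 3
        + r * (2 / α) * ‖x‖ := by
  have hβ : embedActive (activeBlock β₀) = β₀ := embedActive_activeBlock h_inactive
  have hdiff : embedActive (activeBlock β₀ + x) - β₀ = embedActive x := by
    conv_lhs => rw [← hβ]
    rw [activeBlock_embedActive, ← embedActive_sub, add_sub_cancel_left]
  have h1 := abs_logLik_sub_le hn h.regular hB (norm_nonneg x)
    ((Metric.closedBall_subset_closedBall hx).trans hsub)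
    (b := embedActive (activeBlock β₀ + x)) (b' := β₀)
    (by rw [hdiff, norm_embedActive]) (by simp)
  rw [hdiff, inner_embedActive, norm_embedActive, sub_self] at h1
  have hz : quadForm (sampleInfo f β₀ y) 0 = 0 := by simp [quadForm]
  rw [hz, sub_zero] at h1
  have h2 := abs_quadForm_sub_le h.info_close (embedActive x)
  rw [norm_embedActive, quadForm_embedActive J] at h2
  have h3 := abs_totalPenalty_sub_le (s := s) hp hτ hα ha (hx.trans hδα)
  rw [hβ] at h3
  have h4 : n * (((r + s : ℕ) : ℝ) ^ 3 * sampleMean M y * ‖x‖ ^ 2 * ‖x‖) ≤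
      n * (((r + s : ℕ) : ℝ) ^ 3 * m₀ * ‖x‖ ^ 2 * ‖x‖) := by
    gcongr
    exact h.mean_le
  have h5 := mul_le_mul_of_nonneg_left h2 (by positivity : (0 : ℝ) ≤ n / 2)
  rw [add_zero, hβ, penalizedLoss_eq, penalizedLoss_eq]
  set X := logLik f y (embedActive (activeBlock β₀ + x)) - logLik f y β₀ with hX
  set Z := √(n : ℝ) * inner ℝ (activeBlock (sampleScore f β₀ y)) x
  set W := quadForm (sampleInfo f β₀ y) (embedActive x)
  set V := quadForm (J.submatrix (Fin.castAdd s) (Fin.castAdd s)) x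
  set R := totalPenalty p τ (embedActive (activeBlock β₀ + x) : EuclideanSpace ℝ (Fin (r + s)))
    - totalPenalty p τ β₀ with hR
  have e : -logLik f y (embedActive (activeBlock β₀ + x))
      + totalPenalty p τ (embedActive (activeBlock β₀ + x) : EuclideanSpace ℝ (Fin (r + s)))
      - (-logLik f y β₀ + totalPenalty p τ β₀) + Z - n / 2 * V
      = -(X - Z + n / 2 * W) + n / 2 * (W - V) + R := by
    rw [hX, hR]
    ring
  have h6 : |n / 2 * (W - V)| = n / 2 * |W - V| := by rw [abs_mul, abs_of_nonneg (by positivity)]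
  have h7 : 0 ≤ n / 2 * (((r + s : ℕ) : ℝ) ^ 2 * (η * ‖x‖ ^ 2)) :=
    le_trans (by positivity) h5
  rw [e]
  refine (abs_add_le _ _).trans ((add_le_add ((abs_add_le _ _).trans
    (add_le_add ((abs_neg _).trans_le (h1.trans h4)) (h6.le.trans h5))) h3).trans ?_)
  linarith

/-- Deterministic core of the oracle property. -/
lemma exists_radius_local_minimizer {Θ : Set (EuclideanSpace ℝ (Fin (r + s)))}
    (hB : IsOpen B) (hβB : β₀ ∈ B)
    (h_active : ∀ j, activeBlock β₀ j ≠ 0) (h_inactive : inactiveBlock β₀ = 0)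
    (hJ : J.PosDef) (hp : RegularHyperprior p) {τ₀ m₀ : ℝ} (hτ₀ : 0 < τ₀) (hm₀ : 0 ≤ m₀) :
    ∃ δ > 0, Metric.closedBall β₀ δ ⊆ B ∧
      (∀ x : EuclideanSpace ℝ (Fin r), ‖x‖ ≤ δ → ∀ j, (activeBlock β₀ + x) j ≠ 0) ∧
      ∀ K, 0 ≤ K → ∀ ε > 0, ∃ η > 0, ∀ᶠ n : ℕ in atTop, ∀ y : Fin n → S,
        RegularSample f B M β₀ J m₀ K η y → ∀ u x : EuclideanSpace ℝ (Fin r),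
        Matrix.toEuclideanLin (J.submatrix (Fin.castAdd s) (Fin.castAdd s)) u =
          activeBlock (sampleScore f β₀ y) → ‖x‖ ≤ δ →
        (∀ x', ‖x'‖ ≤ δ → penalizedLoss f p (n * τ₀) y (embedActive (activeBlock β₀ + x)) ≤
          penalizedLoss f p (n * τ₀) y (embedActive (activeBlock β₀ + x'))) →
        ‖√(n : ℝ) • x - u‖ ≤ ε ∧
          IsLocalMinOn (penalizedLoss f p (n * τ₀) y) Θ (embedActive (activeBlock β₀ + x)) := by
  set J₁ := J.submatrix (Fin.castAdd s) (Fin.castAdd s) with hJ₁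
  have hJ₁pd : J₁.PosDef := hJ.submatrix (Fin.castAdd_injective r s)
  obtain ⟨c, hc0, hc⟩ := exists_pos_mul_norm_sq_le_quadForm hJ₁pd
  obtain ⟨a, ha0, ha⟩ := hp.exists_profile_zero_add_le
  obtain ⟨A, hA⟩ : ∃ A : ℝ, ∀ j k, |J j k| ≤ A :=
    ⟨∑ j, ∑ k, |J j k|, fun j k =>
      (Finset.single_le_sum (f := fun k => |J j k|) (fun _ _ => abs_nonneg _)
        (Finset.mem_univ k)).trans
      (Finset.single_le_sum (f := fun j => ∑ k, |J j k|)
        (fun _ _ => Finset.sum_nonneg fun _ _ => abs_nonneg _) (Finset.mem_univ j))⟩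
  obtain ⟨α, hαa, hα⟩ : ∃ α : ℝ, (∀ j, α ≤ |activeBlock β₀ j|) ∧ 0 < α := by
    have : ∀ᶠ α in 𝓝[>] (0 : ℝ), ∀ j, α ≤ |activeBlock β₀ j| :=
      eventually_all.2 fun j => eventually_nhdsWithin_of_eventually_nhds
        (eventually_le_nhds (abs_pos.2 (h_active j)))
    exact (this.and self_mem_nhdsWithin).exists
  set P := ((r + s : ℕ) : ℝ) with hP
  -- In order: the expansion is valid, active coordinates stay off zero, the cubic error is absorbed
  -- by the curvature, and the likelihood slope uses half of the kink `τ₀ a`. The other half is for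
  -- the score. None of this involves `K` or `ε`, so one estimator serves all of them; `A + 1`
  -- anticipates `η ≤ 1`.
  obtain ⟨δ, ⟨hsub, hδα, hδc, hδa⟩, hδ⟩ : ∃ δ : ℝ, (Metric.closedBall β₀ δ ⊆ B ∧ δ < α / 2 ∧
      P ^ 3 * m₀ * δ < c / 8 ∧
      P ^ 2 * (A + 1) * δ + P ^ 3 * m₀ * δ ^ 2 < τ₀ * a / 2) ∧ 0 < δ := by
    have h1 : ∀ᶠ δ in 𝓝[>] (0 : ℝ), Metric.closedBall β₀ δ ⊆ B := by
      obtain ⟨ε, hε, hsub⟩ := Metric.isOpen_iff.1 hB β₀ hβB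
      filter_upwards [eventually_nhdsWithin_of_eventually_nhds (eventually_lt_nhds hε)] with δ hδ
      exact (Metric.closedBall_subset_ball hδ).trans hsub
    have h2 : ∀ g : ℝ → ℝ, Continuous g → ∀ t, g 0 < t → ∀ᶠ δ in 𝓝[>] (0 : ℝ), g δ < t :=
      fun g hg t ht => eventually_nhdsWithin_of_eventually_nhds
        (hg.continuousAt.eventually_lt continuousAt_const ht)
    exact ((h1.and ((h2 (fun δ => δ) continuous_id _ (by positivity)).and
      ((h2 (fun δ => P ^ 3 * m₀ * δ) (by fun_prop) _ (by simpa using hc0)).and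
        (h2 (fun δ => P ^ 2 * (A + 1) * δ + P ^ 3 * m₀ * δ ^ 2) (by fun_prop) _
          (by simp; positivity))))).and self_mem_nhdsWithin).exists
  refine ⟨δ, hδ, hsub, fun x hx j => ?_, fun K hK ε hε => ?_⟩
  · have := half_le_abs_add (hαa j) ((abs_apply_le_norm x j).trans (hx.trans hδα.le))
    exact abs_pos.1 (lt_of_lt_of_le (by positivity) this)
  have hsymm : (Matrix.toEuclideanLin J₁).IsSymmetric :=
    Matrix.isSymmetric_toEuclideanLin_iff.2 hJ₁pd.isHermitian
  obtain ⟨η₀, hη₀, hclose⟩ := exists_eventually_argmin_close hsymm hc0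
    (fun v => (hc v).trans_eq (quadForm_eq_inner _ _)) (m := P ^ 3 * m₀) (C := r * (2 / α))
    (by positivity) (by positivity) hδ hδc.le hK hε
  refine ⟨min 1 (η₀ / (P ^ 2 + 1)), by positivity, ?_⟩
  set η := min 1 (η₀ / (P ^ 2 + 1))
  have hη1 : η ≤ 1 := min_le_left _ _
  have hη2 : P ^ 2 * η ≤ η₀ := by
    have h1 : η * (P ^ 2 + 1) ≤ η₀ := (le_div_iff₀ (by positivity)).1 (min_le_right _ _)
    have h2 : 0 ≤ η := by positivity
    linarith
  have hsqrt : Tendsto (fun n : ℕ => √(n : ℝ)) atTop atTop :=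
    Real.tendsto_sqrt_atTop.comp tendsto_natCast_atTop_atTop
  filter_upwards [hclose, eventually_ne_atTop 0,
    hsqrt.eventually_ge_atTop (K / (τ₀ * a / 2))] with n hcl hn hnK y hy u x hu hx hmin
  rw [div_le_iff₀ (by positivity)] at hnK
  have hτ : 0 ≤ n * τ₀ := by positivity
  obtain ⟨h1, h2⟩ := hcl u x (fun x => penalizedLoss f p (n * τ₀) y
      (embedActive (activeBlock β₀ + x)))
    (by rw [hu]; exact (norm_activeBlock_le _).trans hy.score_le)
    (fun z hz => by
      have := hy.abs_penalizedLoss_sub_quadratic_le hn hB hsub hp hτ hα h_inactive hαa hδα.le hz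
      rw [hu, ← quadForm_eq_inner]
      refine this.trans ?_
      gcongr) hx hmin
  refine ⟨h1, (isLocalMin_penalizedLoss h_inactive hτ ha0 ha (fun b b' hb hb' => ?_) h2
    hmin).on Θ⟩
  refine (hy.abs_logLik_sub_le_mul hn hB hδ.le hsub hA hb hb').trans ?_
  gcongr
  have h3 : √(n : ℝ) * K ≤ n * (τ₀ * a / 2) := by
    calc √(n : ℝ) * K ≤ √(n : ℝ) * (√(n : ℝ) * (τ₀ * a / 2)) := by gcongr
      _ = n * (τ₀ * a / 2) := by rw [← mul_assoc, Real.mul_self_sqrt n.cast_nonneg]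
  have h4 : P ^ 2 * (A + η) * δ + P ^ 3 * m₀ * δ ^ 2 ≤ τ₀ * a / 2 := by
    refine le_trans ?_ hδa.le
    gcongr
  have h5 := mul_le_mul_of_nonneg_left h4 (Nat.cast_nonneg n : (0 : ℝ) ≤ n)
  linarith

end Deterministic

/-! ### Limit theorems for samples -/

section Limits

variable {S Ω : Type*} [MeasurableSpace S] [MeasurableSpace Ω] {ν : Measure S} {P : Measure Ω}
  {Y : ℕ → Ω → S}

lemma HasLaw.comp_aemeasurable {E : Type*} [MeasurableSpace E] (hY : ∀ i, HasLaw (Y i) ν P)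
    {g : S → E} (hg : AEMeasurable g ν) (i : ℕ) : AEMeasurable (fun ω => g (Y i ω)) P :=
  AEMeasurable.comp_aemeasurable (by rwa [(hY i).map_eq]) (hY i).aemeasurable

lemma iIndepFun.comp_hasLaw {E : Type*} [MeasurableSpace E] (hY : ∀ i, HasLaw (Y i) ν P)
    (hindep : iIndepFun Y P) {g : S → E} (hg : AEMeasurable g ν) :
    iIndepFun (fun i ω => g (Y i ω)) P :=
  hindep.comp₀ (fun _ => g) (fun i => (hY i).aemeasurable) fun i => by rwa [(hY i).map_eq]

lemma HasLaw.identDistrib_comp {E : Type*} [MeasurableSpace E] (hY : ∀ i, HasLaw (Y i) ν P)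
    {g : S → E} (hg : AEMeasurable g ν) (i : ℕ) :
    IdentDistrib (fun ω => g (Y i ω)) (fun ω => g (Y 0 ω)) P P :=
  ((hY i).identDistrib (hY 0)).comp_of_aemeasurable (by rwa [(hY i).map_eq])

/-- Weak law of large numbers. -/
lemma tendsto_measure_abs_sampleMean_sub (hY : ∀ i, HasLaw (Y i) ν P)
    (hindep : iIndepFun Y P) [IsProbabilityMeasure P] {g : S → ℝ} (hg : Integrable g ν) {η : ℝ}
    (hη : 0 < η) :
    Tendsto (fun n : ℕ => P {ω | η ≤ |sampleMean g (fun i : Fin n => Y i ω) - ∫ y, g y ∂ν|})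
      atTop (𝓝 0) := by
  have hm := hg.aestronglyMeasurable.aemeasurable
  have hint : Integrable (fun ω => g (Y 0 ω)) P := by
    have : Integrable g (P.map (Y 0)) := by rwa [(hY 0).map_eq]
    exact this.comp_aemeasurable (hY 0).aemeasurable
  have hlln := strong_law_ae_real (fun i ω => g (Y i ω)) hint
    (fun i j hij => (iIndepFun.comp_hasLaw hY hindep hm).indepFun hij)
    (HasLaw.identDistrib_comp hY hm)
  have hexp : ∫ ω, g (Y 0 ω) ∂P = ∫ y, g y ∂ν := by
    have := (hY 0).integral_comp hg.aestronglyMeasurable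
    exact this
  have hsum : ∀ n : ℕ, AEStronglyMeasurable (fun ω => (∑ i ∈ Finset.range n, g (Y i ω)) / n) P :=
    fun n => ((Finset.aemeasurable_fun_sum _ fun i _ =>
      HasLaw.comp_aemeasurable hY hm i).div_const _).aestronglyMeasurable
  have h := tendstoInMeasure_of_tendsto_ae hsum hlln
  rw [tendstoInMeasure_iff_norm] at h
  have h' := h η hη
  simp only [hexp] at h'
  refine h'.congr fun n => ?_
  simp only [sampleMean, Real.norm_eq_abs, Finset.sum_range]

lemma HasLaw.aemeasurable_inv_sqrt_smul_sum (hY : ∀ i, HasLaw (Y i) ν P) {r : ℕ}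
    {ξ : S → EuclideanSpace ℝ (Fin r)} (hξ : AEMeasurable ξ ν) (n : ℕ) :
    AEMeasurable (fun ω => (√(n : ℝ))⁻¹ • ∑ i : Fin n, ξ (Y i ω)) P := by
  have h1 : ∀ i : Fin n, AEMeasurable (fun ω => ξ (Y i ω)) P := fun i =>
    HasLaw.comp_aemeasurable hY hξ (i : ℕ)
  have h2 : AEMeasurable (fun ω => ∑ i : Fin n, ξ (Y i ω)) P :=
    Finset.aemeasurable_fun_sum _ fun i _ => h1 i
  exact (continuous_const_smul (√(n : ℝ))⁻¹).measurable.comp_aemeasurable h2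

/-- Central limit theorem for centered functions of a sample. -/
lemma tendstoInDistribution_inv_sqrt_mul_sum_comp (hY : ∀ i, HasLaw (Y i) ν P)
    (hindep : iIndepFun Y P) [IsProbabilityMeasure P] {g : S → ℝ} {v : ℝ}
    (hL2 : MemLp g 2 ν) (hmean : ∫ y, g y ∂ν = 0) (hvar : ∫ y, g y ^ 2 ∂ν = v) :
    TendstoInDistribution (fun (n : ℕ) ω => (√(n : ℝ))⁻¹ * ∑ i : Fin n, g (Y i ω))
      atTop id (fun _ => P) (gaussianReal 0 v.toNNReal) := by
  have hm : AEMeasurable g ν := hL2.aemeasurable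
  have hmean0 : ∫ ω, g (Y 0 ω) ∂P = 0 := by
    rw [← hmean]
    exact (hY 0).integral_comp hm.aestronglyMeasurable
  have hsq0 : ∫ ω, g (Y 0 ω) ^ 2 ∂P = v := by
    rw [← hvar]
    exact (hY 0).integral_comp (f := fun y => g y ^ 2) (hm.pow_const 2).aestronglyMeasurable
  have hL2' : MemLp (fun ω => g (Y 0 ω)) 2 P := by
    have : MemLp g 2 (P.map (Y 0)) := by rwa [(hY 0).map_eq]
    exact this.comp_of_map (hY 0).aemeasurable
  have hvar0 : Var[fun ω => g (Y 0 ω); P] = v := by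
    rw [variance_of_integral_eq_zero (HasLaw.comp_aemeasurable hY hm 0) hmean0, ← hsq0]
  have hclt := tendstoInDistribution_inv_sqrt_mul_sum_sub (X := fun i ω => g (Y i ω))
    (P' := gaussianReal 0 v.toNNReal) (Y := id)
    (by rw [hvar0]; exact HasLaw.id) hL2' (iIndepFun.comp_hasLaw hY hindep hm)
    (HasLaw.identDistrib_comp hY hm)
  simpa only [hmean0, mul_zero, sub_zero, Finset.sum_range] using hclt

/-- Multivariate central limit theorem. -/
lemma tendstoInDistribution_inv_sqrt_smul_sum (hY : ∀ i, HasLaw (Y i) ν P)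
    (hindep : iIndepFun Y P) [IsProbabilityMeasure P] {r : ℕ} {ξ : S → EuclideanSpace ℝ (Fin r)}
    (hξ : AEMeasurable ξ ν) {A : Matrix (Fin r) (Fin r) ℝ} (hA : A.PosSemidef)
    (hL2 : ∀ t, MemLp (fun y => (inner ℝ (ξ y) t : ℝ)) 2 ν)
    (hmean : ∀ t, ∫ y, (inner ℝ (ξ y) t : ℝ) ∂ν = 0)
    (hvar : ∀ t, ∫ y, (inner ℝ (ξ y) t : ℝ) ^ 2 ∂ν = quadForm A t) :
    TendstoInDistribution (fun (n : ℕ) ω => (√(n : ℝ))⁻¹ • ∑ i : Fin n, ξ (Y i ω))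
      atTop id (fun _ => P) (multivariateGaussian 0 A) where
  forall_aemeasurable n := HasLaw.aemeasurable_inv_sqrt_smul_sum hY hξ n
  tendsto := by
    -- Cramér–Wold: the characteristic function at `t` is that of the scalar sum of `⟪ξ, t⟫` at 1.
    refine ProbabilityMeasure.tendsto_iff_tendsto_charFun.2 fun t => ?_
    have hclt := tendstoInDistribution_inv_sqrt_mul_sum_comp hY hindep (hL2 t) (hmean t) (hvar t)
    have h1 := ProbabilityMeasure.tendsto_iff_tendsto_charFun.1 hclt.tendsto 1
    have hnn : 0 ≤ quadForm A t := by
      rw [← hvar t]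
      exact integral_nonneg fun y => sq_nonneg _
    have hq : t.ofLp ⬝ᵥ A.mulVec t.ofLp = quadForm A t := by
      simp only [quadForm, dotProduct, Matrix.mulVec, Finset.mul_sum]
      exact Finset.sum_congr rfl fun j _ => Finset.sum_congr rfl fun k _ => by ring
    have hlim : charFun ((gaussianReal 0 (quadForm A t).toNNReal).map id) 1
        = charFun ((multivariateGaussian 0 A).map id) t := by
      rw [Measure.map_id, Measure.map_id, charFun_gaussianReal, charFun_multivariateGaussian hA,
        hq, Real.coe_toNNReal _ hnn]
      simp
    refine (hlim ▸ h1).congr fun n => ?_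
    simp only [ProbabilityMeasure.coe_mk]
    rw [charFun_apply, charFun_apply,
      integral_map (HasLaw.aemeasurable_inv_sqrt_smul_sum hY hξ n) (by fun_prop),
      integral_map (hclt.forall_aemeasurable n) (by fun_prop)]
    refine integral_congr_ae (Eventually.of_forall fun ω => ?_)
    simp only [real_inner_smul_left, sum_inner]
    simp

/-- A sequence that converges in distribution is bounded in probability. -/
lemma exists_forall_measure_norm_gt_le [IsProbabilityMeasure P] {m : ℕ}
    {X : ℕ → Ω → EuclideanSpace ℝ (Fin m)} {γ : Measure (EuclideanSpace ℝ (Fin m))}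
    [IsProbabilityMeasure γ] (h : TendstoInDistribution X atTop id (fun _ => P) γ)
    {ε : ENNReal} (hε : 0 < ε) :
    ∃ K, 0 ≤ K ∧ ∀ n, P {ω | K < ‖X n ω‖} ≤ ε := by
  have hprob : ∀ n, IsProbabilityMeasure (P.map (X n)) := fun n =>
    Measure.isProbabilityMeasure_map (h.forall_aemeasurable n)
  have hchar := ProbabilityMeasure.tendsto_iff_tendsto_charFun.1 h.tendsto
  simp only [ProbabilityMeasure.coe_mk, Measure.map_id] at hchar
  -- Convergence of characteristic functions to a limit continuous at 0 gives tightness, hence one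
  -- `K` for all `n`.
  have htight := isTightMeasureSet_of_tendsto_charFun (μ := fun n => P.map (X n))
    (f := charFun γ) (continuous_charFun.continuousAt) hchar
  rw [isTightMeasureSet_iff_tendsto_measure_norm_gt] at htight
  obtain ⟨K, hK, hK0⟩ := ((ENNReal.tendsto_nhds_zero.1 htight ε hε).and
    (eventually_ge_atTop 0)).exists
  refine ⟨K, hK0, fun n => ?_⟩
  have h1 : P.map (X n) {x | K < ‖x‖} ≤ ε :=
    le_trans (le_iSup₂_of_le (P.map (X n)) (Set.mem_range_self n) le_rfl) hK
  rwa [Measure.map_apply_of_aemeasurable (h.forall_aemeasurable n)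
    (measurableSet_lt measurable_const measurable_norm)] at h1

end Limits

/-! ### Moments of the score -/

lemma inner_scoreVec {m : ℕ} {S : Type*} (f : EuclideanSpace ℝ (Fin m) → S → ℝ)
    (β₀ v : EuclideanSpace ℝ (Fin m)) (y : S) :
    (inner ℝ (scoreVec f β₀ y) v : ℝ) = ∑ j, v j * score f β₀ j y := by
  simp [PiLp.inner_apply, scoreVec]

section Score

variable {m : ℕ} {S : Type*} [MeasurableSpace S] {μ : Measure S}
  {Θ : Set (EuclideanSpace ℝ (Fin m))} {f : EuclideanSpace ℝ (Fin m) → S → ℝ}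
  {β₀ : EuclideanSpace ℝ (Fin m)}

lemma RegularModel.aemeasurable_scoreVec (h : RegularModel μ Θ f β₀) :
    AEMeasurable (scoreVec f β₀) (modelLaw μ f β₀) := by
  have : AEMeasurable (fun y j => score f β₀ j y) (modelLaw μ f β₀) :=
    aemeasurable_pi_lambda _ fun j => (h.integrable_score j).aestronglyMeasurable.aemeasurable
  exact (WithLp.measurable_toLp 2 _).comp_aemeasurable this

lemma RegularModel.memLp_inner_scoreVec (h : RegularModel μ Θ f β₀)
    (v : EuclideanSpace ℝ (Fin m)) :
    MemLp (fun y => (inner ℝ (scoreVec f β₀ y) v : ℝ)) 2 (modelLaw μ f β₀) := by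
  simp only [inner_scoreVec]
  refine memLp_finsetSum _ fun j _ => MemLp.const_mul ?_ (v j)
  refine (memLp_two_iff_integrable_sq (h.integrable_score j).aestronglyMeasurable).2 ?_
  simpa only [sq] using h.integrable_score_mul j j

lemma RegularModel.integral_inner_scoreVec (h : RegularModel μ Θ f β₀)
    (v : EuclideanSpace ℝ (Fin m)) :
    ∫ y, (inner ℝ (scoreVec f β₀ y) v : ℝ) ∂(modelLaw μ f β₀) = 0 := by
  simp only [inner_scoreVec]
  rw [integral_finsetSum _ fun j _ => (h.integrable_score j).const_mul (v j)]
  simp [integral_const_mul, h.integral_score]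

lemma RegularModel.integral_inner_scoreVec_sq (h : RegularModel μ Θ f β₀)
    (v : EuclideanSpace ℝ (Fin m)) :
    ∫ y, (inner ℝ (scoreVec f β₀ y) v : ℝ) ^ 2 ∂(modelLaw μ f β₀) =
      quadForm (fisherInfo μ f β₀) v := by
  have e : ∀ y, (inner ℝ (scoreVec f β₀ y) v : ℝ) ^ 2 =
      ∑ j, ∑ k, (v j * v k) * (score f β₀ j y * score f β₀ k y) := by
    intro y
    rw [inner_scoreVec, sq, Finset.sum_mul_sum]
    exact Finset.sum_congr rfl fun j _ => Finset.sum_congr rfl fun k _ => by ring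
  simp only [e]
  rw [integral_finsetSum _ fun j _ => integrable_finsetSum _ fun k _ =>
    (h.integrable_score_mul j k).const_mul _]
  refine Finset.sum_congr rfl fun j _ => ?_
  rw [integral_finsetSum _ fun k _ => (h.integrable_score_mul j k).const_mul _]
  refine Finset.sum_congr rfl fun k _ => ?_
  rw [integral_const_mul, fisherInfo, Matrix.of_apply, mul_comm]

end Score

lemma continuousAt_logLik {m : ℕ} {S : Type*} {f : EuclideanSpace ℝ (Fin m) → S → ℝ}
    {B : Set (EuclideanSpace ℝ (Fin m))} {M : S → ℝ} {n : ℕ} {y : Fin n → S}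
    (hy : ∀ i, RegularObservation f B M (y i)) {b : EuclideanSpace ℝ (Fin m)} (hb : b ∈ B) :
    ContinuousAt (logLik f y) b := by
  unfold logLik
  exact tendsto_finsetSum _ fun i _ => ((hy i).thrice.first b hb).continuousAt

/-! ### Regular samples have probability close to one -/

section Model

variable {r s : ℕ} {S : Type*} [MeasurableSpace S] {μ : Measure S}
  {Θ : Set (EuclideanSpace ℝ (Fin (r + s)))} {f : EuclideanSpace ℝ (Fin (r + s)) → S → ℝ}
  {β₀ : EuclideanSpace ℝ (Fin (r + s))} {B : Set (EuclideanSpace ℝ (Fin (r + s)))} {M : S → ℝ}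

/-- Under the true law `f β₀ y > 0` almost surely. The common support extends positivity to all of
`B`, so the logarithm inherits the smoothness of the density. -/
lemma RegularModel.exists_ae_regularObservation (h : RegularModel μ Θ f β₀) :
    ∃ (B : Set (EuclideanSpace ℝ (Fin (r + s)))) (M : S → ℝ), IsOpen B ∧ β₀ ∈ B ∧ B ⊆ Θ ∧
      Integrable M (modelLaw μ f β₀) ∧ 0 ≤ M ∧
      ∀ᵐ y ∂(modelLaw μ f β₀), RegularObservation f B M y := by
  obtain ⟨B, hB, hβB, hBΘ, hdiff, M, hM, hbound⟩ := h.third_order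
  refine ⟨B, fun y => ∑ i, ∑ j, ∑ k, |M i j k y|, hB, hβB, hBΘ,
    integrable_finsetSum _ fun i _ => integrable_finsetSum _ fun j _ =>
      integrable_finsetSum _ fun k _ => (hM i j k).abs,
    fun y => Finset.sum_nonneg fun i _ => Finset.sum_nonneg fun j _ =>
      Finset.sum_nonneg fun k _ => abs_nonneg _, ?_⟩
  have hβΘ := hBΘ hβB
  rw [modelLaw, ae_withDensity_iff (h.measurable_density β₀ hβΘ).ennreal_ofReal]
  filter_upwards [hdiff, hbound] with y hy1 hy2 hpos
  have hpos' : 0 < f β₀ y := by simpa using hpos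
  refine ⟨(thriceDifferentiableOn_of_iteratedFDeriv hB hy1).log hB fun b hb => ?_,
    Finset.sum_nonneg fun i _ => Finset.sum_nonneg fun j _ =>
      Finset.sum_nonneg fun k _ => abs_nonneg _, fun b hb i j k => ?_⟩
  · have : y ∈ {y | 0 < f b y} := by
      rw [h.common_support b (hBΘ hb) β₀ hβΘ]
      exact hpos'
    exact this
  · refine (hy2 b hb i j k).trans ((le_abs_self _).trans ?_)
    refine (Finset.single_le_sum (f := fun k => |M i j k y|) (fun _ _ => abs_nonneg _)
      (Finset.mem_univ k)).trans ?_
    refine (Finset.single_le_sum (f := fun j => ∑ k, |M i j k y|)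
      (fun _ _ => Finset.sum_nonneg fun _ _ => abs_nonneg _) (Finset.mem_univ j)).trans ?_
    exact Finset.single_le_sum (f := fun i => ∑ j, ∑ k, |M i j k y|)
      (fun _ _ => Finset.sum_nonneg fun _ _ => Finset.sum_nonneg fun _ _ => abs_nonneg _)
      (Finset.mem_univ i)

variable {Ω : Type*} [MeasurableSpace Ω] {P : Measure Ω} {Y : ℕ → Ω → S}

lemma RegularModel.tendstoInDistribution_sampleScore [IsProbabilityMeasure P]
    (h : RegularModel μ Θ f β₀) (hY : ∀ i, HasLaw (Y i) (modelLaw μ f β₀) P)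
    (hindep : iIndepFun Y P) :
    TendstoInDistribution (fun (n : ℕ) ω => sampleScore f β₀ fun i : Fin n => Y i ω)
      atTop id (fun _ => P) (multivariateGaussian 0 (fisherInfo μ f β₀)) :=
  tendstoInDistribution_inv_sqrt_smul_sum hY hindep h.aemeasurable_scoreVec
    h.fisherInfo_posDef.posSemidef h.memLp_inner_scoreVec h.integral_inner_scoreVec
    h.integral_inner_scoreVec_sq

/-- Tightness of the score uses `ε / 2` and fixes `K` before `η` is known; the laws of large numbers
for the Hessian entries and for `M` use the rest. -/
lemma RegularModel.exists_eventually_measure_not_regularSample_le [IsProbabilityMeasure P]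
    (h : RegularModel μ Θ f β₀) (hY : ∀ i, HasLaw (Y i) (modelLaw μ f β₀) P)
    (hindep : iIndepFun Y P) (hM : Integrable M (modelLaw μ f β₀)) {G : Set S}
    (hG : ∀ᵐ y ∂(modelLaw μ f β₀), y ∈ G) (hGreg : ∀ y ∈ G, RegularObservation f B M y)
    {ε : ENNReal} (hε : 0 < ε) :
    ∃ K, 0 ≤ K ∧ ∀ η > 0, ∀ᶠ n : ℕ in atTop,
      P {ω | ¬ ((∀ i : Fin n, Y i ω ∈ G) ∧
        RegularSample f B M β₀ (fisherInfo μ f β₀) (∫ y, M y ∂(modelLaw μ f β₀) + 1) K η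
          fun i : Fin n => Y i ω)} ≤ ε := by
  obtain ⟨K, hK, hKle⟩ := exists_forall_measure_norm_gt_le
    (h.tendstoInDistribution_sampleScore hY hindep) (ENNReal.half_pos hε.ne')
  refine ⟨K, hK, fun η hη => ?_⟩
  have hGY : ∀ᵐ ω ∂P, ∀ i, Y i ω ∈ G := ae_all_iff.2 fun i => by
    rw [← (hY i).map_eq] at hG
    exact ae_of_ae_map (hY i).aemeasurable hG
  have hinfo : ∀ j k, Tendsto (fun n : ℕ => P {ω | η ≤
      |sampleInfo f β₀ (fun i : Fin n => Y i ω) j k - fisherInfo μ f β₀ j k|}) atTop (𝓝 0) := by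
    intro j k
    have := tendsto_measure_abs_sampleMean_sub hY hindep (h.integrable_hessian j k).neg hη
    rw [h.fisherInfo_eq j k, ← integral_neg]
    exact this
  have hmean := tendsto_measure_abs_sampleMean_sub hY hindep hM one_pos
  have hsum : Tendsto (fun n : ℕ => P {ω | 1 ≤ |sampleMean M (fun i : Fin n => Y i ω)
        - ∫ y, M y ∂(modelLaw μ f β₀)|} + ∑ j, ∑ k, P {ω | η ≤
      |sampleInfo f β₀ (fun i : Fin n => Y i ω) j k - fisherInfo μ f β₀ j k|})
      atTop (𝓝 0) := by
    have h2 := hmean.add (tendsto_finsetSum Finset.univ fun j _ =>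
      tendsto_finsetSum Finset.univ fun k _ => hinfo j k)
    simpa using h2
  filter_upwards [ENNReal.tendsto_nhds_zero.1 hsum _ (ENNReal.half_pos hε.ne')] with n hn
  have hsub : {ω | ¬ ((∀ i : Fin n, Y i ω ∈ G) ∧
        RegularSample f B M β₀ (fisherInfo μ f β₀) (∫ y, M y ∂(modelLaw μ f β₀) + 1) K η
          fun i : Fin n => Y i ω)} ⊆
      {ω | ¬ ∀ i, Y i ω ∈ G} ∪ ({ω | K < ‖sampleScore f β₀ fun i : Fin n => Y i ω‖} ∪
        ({ω | 1 ≤ |sampleMean M (fun i : Fin n => Y i ω) - ∫ y, M y ∂(modelLaw μ f β₀)|} ∪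
        ⋃ j, ⋃ k, {ω | η ≤
          |sampleInfo f β₀ (fun i : Fin n => Y i ω) j k - fisherInfo μ f β₀ j k|})) := by
    intro ω hω
    by_contra hcon
    simp only [Set.mem_union, Set.mem_iUnion, Set.mem_ofPred_eq, not_or, not_not, not_exists,
      not_lt, not_le] at hcon
    obtain ⟨h1, h2, h3, h4⟩ := hcon
    refine hω ⟨fun i => h1 i, fun i => hGreg _ (h1 i), h2, fun j k => (h4 j k).le, ?_⟩
    linarith [(abs_lt.1 h3).2]
  refine (measure_mono hsub).trans ?_
  have hnull : P {ω | ¬ ∀ i, Y i ω ∈ G} = 0 := hGY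
  calc _ ≤ 0 + (ε / 2 + ε / 2) := by
        refine (measure_union_le _ _).trans (add_le_add hnull.le ?_)
        refine (measure_union_le _ _).trans (add_le_add (hKle n) ?_)
        refine (measure_union_le _ _).trans (le_trans (add_le_add le_rfl ?_) hn)
        refine (measure_iUnion_fintype_le _ _).trans (Finset.sum_le_sum fun j _ => ?_)
        exact measure_iUnion_fintype_le _ _
    _ = ε := by rw [zero_add, ENNReal.add_halves]

/-! ### The estimator -/

lemma RegularModel.exists_measurable_active_argmin (h : RegularModel μ Θ f β₀)
    (h_inactive : inactiveBlock β₀ = 0) {p : ℝ → ℝ} (hp : RegularHyperprior p) {τ δ : ℝ}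
    (hτ : 0 ≤ τ) (hδ : 0 < δ) (hsub : Metric.closedBall β₀ δ ⊆ B) (hBΘ : B ⊆ Θ)
    (hne : ∀ x : EuclideanSpace ℝ (Fin r), ‖x‖ ≤ δ → ∀ j, (activeBlock β₀ + x) j ≠ 0)
    {G : Set S} (hGm : MeasurableSet G) (hGreg : ∀ y ∈ G, RegularObservation f B M y) (n : ℕ) :
    ∃ xhat : (Fin n → S) → EuclideanSpace ℝ (Fin r), Measurable xhat ∧ (∀ y, ‖xhat y‖ ≤ δ) ∧
      ∀ y, (∀ i, y i ∈ G) → ∀ x', ‖x'‖ ≤ δ →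
        penalizedLoss f p τ y (embedActive (activeBlock β₀ + xhat y)) ≤
          penalizedLoss f p τ y (embedActive (activeBlock β₀ + x')) := by
  classical
  have hmem : ∀ x : EuclideanSpace ℝ (Fin r), ‖x‖ ≤ δ → embedActive (activeBlock β₀ + x) ∈ B := by
    intro x hx
    refine hsub ?_
    rw [mem_closedBall_iff_norm]
    conv_lhs => rw [← embedActive_activeBlock h_inactive]
    rwa [activeBlock_embedActive, ← embedActive_sub, add_sub_cancel_left, norm_embedActive]
  have : CompactSpace (Metric.closedBall (0 : EuclideanSpace ℝ (Fin r)) δ) :=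
    isCompact_iff_compactSpace.1 (isCompact_closedBall 0 δ)
  have : Nonempty (Metric.closedBall (0 : EuclideanSpace ℝ (Fin r)) δ) :=
    ⟨⟨0, Metric.mem_closedBall_self hδ.le⟩⟩
  have hnorm : ∀ x : Metric.closedBall (0 : EuclideanSpace ℝ (Fin r)) δ,
      ‖(x : EuclideanSpace ℝ (Fin r))‖ ≤ δ := fun x => mem_closedBall_zero_iff.1 x.2
  have hGn : MeasurableSet {y : Fin n → S | ∀ i, y i ∈ G} := by
    simp only [Set.ofPred_forall]
    exact MeasurableSet.iInter fun i => measurable_pi_apply i hGm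
  -- The value 0 off `G` makes `q y` continuous for every sample `y`, as the measurable selection
  -- demands.
  set q : (Fin n → S) → Metric.closedBall (0 : EuclideanSpace ℝ (Fin r)) δ → ℝ := fun y x =>
    if ∀ i, y i ∈ G then penalizedLoss f p τ y (embedActive (activeBlock β₀ + x)) else 0
  have hq : ∀ y, Continuous (q y) := by
    intro y
    by_cases hy : ∀ i, y i ∈ G
    · simp only [q, if_pos hy, penalizedLoss_eq]
      refine continuous_iff_continuousAt.2 fun x => ?_
      have hadd : Continuous fun x : Metric.closedBall (0 : EuclideanSpace ℝ (Fin r)) δ =>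
          activeBlock β₀ + (x : EuclideanSpace ℝ (Fin r)) := by fun_prop
      refine ContinuousAt.add (ContinuousAt.neg ?_) ?_
      · exact ContinuousAt.comp (g := logLik f y)
          (continuousAt_logLik (fun i => hGreg _ (hy i)) (hmem x (hnorm x)))
          (continuous_embedActive.comp hadd).continuousAt
      · exact ContinuousAt.comp (g := fun v : EuclideanSpace ℝ (Fin r) =>
            totalPenalty p τ (embedActive v : EuclideanSpace ℝ (Fin (r + s))))
          (continuousAt_totalPenalty_embedActive hp hτ (hne x (hnorm x))) hadd.continuousAt
    · simp only [q, if_neg hy]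
      exact continuous_const
  have hqm : ∀ x, Measurable fun y => q y x := by
    intro x
    refine Measurable.ite hGn ?_ measurable_const
    simp only [penalizedLoss_eq, logLik, logDensity]
    refine Measurable.add_const (Measurable.neg ?_) _
    refine Finset.measurable_fun_sum _ fun i _ => Real.measurable_log.comp ?_
    exact (h.measurable_density _ (hBΘ (hmem x (hnorm x)))).comp (measurable_pi_apply i)
  obtain ⟨a, ha, hmin⟩ := exists_measurable_argmin q hq hqm
  refine ⟨fun y => a y, measurable_subtype_coe.comp ha, fun y => hnorm _, fun y hy x' hx' => ?_⟩
  have := hmin y ⟨x', mem_closedBall_zero_iff.2 hx'⟩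
  simpa only [q, if_pos hy] using this

/-! ### The efficient limit -/

lemma toEuclideanLin_mul_inv {m : ℕ} {A : Matrix (Fin m) (Fin m) ℝ} (hA : A.PosDef)
    (v : EuclideanSpace ℝ (Fin m)) :
    Matrix.toEuclideanLin A (Matrix.toEuclideanLin A⁻¹ v) = v := by
  have hdet : IsUnit A.det := (Matrix.isUnit_iff_isUnit_det A).1 hA.isUnit
  rw [Matrix.toLpLin_apply, Matrix.toLpLin_apply, Matrix.mulVec_mulVec,
    Matrix.mul_nonsing_inv A hdet, Matrix.one_mulVec]

/-- The central limit theorem is applied to the transformed score itself, whose covariance is `I₁⁻¹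
I₁ I₁⁻¹ = I₁⁻¹`. -/
lemma RegularModel.tendstoInDistribution_inv_info_score [IsProbabilityMeasure P]
    (h : RegularModel μ Θ f β₀) (hY : ∀ i, HasLaw (Y i) (modelLaw μ f β₀) P)
    (hindep : iIndepFun Y P) :
    TendstoInDistribution (fun (n : ℕ) ω => Matrix.toEuclideanLin (activeFisherInfo μ f β₀)⁻¹
        (activeBlock (sampleScore f β₀ fun i : Fin n => Y i ω)))
      atTop id (fun _ => P) (multivariateGaussian 0 (activeFisherInfo μ f β₀)⁻¹) := by
  set J₁ := activeFisherInfo μ f β₀ with hJ₁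
  have hpd : J₁.PosDef := h.fisherInfo_posDef.submatrix (Fin.castAdd_injective r s)
  have hsymm : (Matrix.toEuclideanLin J₁⁻¹).IsSymmetric :=
    Matrix.isSymmetric_toEuclideanLin_iff.2 hpd.inv.isHermitian
  have hinner : ∀ y t, (inner ℝ (Matrix.toEuclideanLin J₁⁻¹ (activeBlock (scoreVec f β₀ y))) t : ℝ)
      = inner ℝ (scoreVec f β₀ y) (embedActive (Matrix.toEuclideanLin J₁⁻¹ t)) := fun y t => by
    rw [inner_embedActive, hsymm]
  have hmeas : Measurable fun v : EuclideanSpace ℝ (Fin (r + s)) =>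
      Matrix.toEuclideanLin J₁⁻¹ (activeBlock v) := by
    refine (LinearMap.continuous_of_finiteDimensional _).measurable.comp ?_
    exact (WithLp.measurable_toLp 2 _).comp (measurable_pi_lambda _ fun j => by fun_prop)
  have hclt := tendstoInDistribution_inv_sqrt_smul_sum hY hindep
    (ξ := fun y => Matrix.toEuclideanLin J₁⁻¹ (activeBlock (scoreVec f β₀ y)))
    (hmeas.comp_aemeasurable h.aemeasurable_scoreVec) hpd.inv.posSemidef
    (fun t => by simpa only [hinner] using h.memLp_inner_scoreVec _)
    (fun t => by simpa only [hinner] using h.integral_inner_scoreVec _)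
    (fun t => by
      simp only [hinner]
      rw [h.integral_inner_scoreVec_sq, quadForm_embedActive]
      change quadForm J₁ _ = _
      rw [quadForm_eq_inner, toEuclideanLin_mul_inv hpd, quadForm_eq_inner, hsymm])
  convert hclt using 3 with n ω
  have : activeBlock (sampleScore f β₀ fun i : Fin n => Y i ω) =
      (√(n : ℝ))⁻¹ • ∑ i : Fin n, activeBlock (scoreVec f β₀ (Y i ω)) := by
    ext j
    simp [sampleScore]
  rw [this, map_smul, map_sum]

end Model

end SBL

end

/-! ### The oracle property -/

theorem theorem3 {r s : ℕ} {S : Type*} [MeasurableSpace S] (μ : Measure S)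
    (Θ : Set (EuclideanSpace ℝ (Fin (r + s))))
    (f : EuclideanSpace ℝ (Fin (r + s)) → S → ℝ)
    (β₀ : EuclideanSpace ℝ (Fin (r + s)))
    (h_active : ∀ j, SBL.activeBlock β₀ j ≠ 0) (h_inactive : SBL.inactiveBlock β₀ = 0)
    (h_model : SBL.RegularModel μ Θ f β₀)
    (p : ℝ → ℝ) (h_prior : SBL.RegularHyperprior p)
    (τ₀ : ℝ) (hτ₀ : 0 < τ₀)
    {Ω : Type*} [MeasurableSpace Ω] (P : Measure Ω) [IsProbabilityMeasure P]
    (Y : ℕ → Ω → S) (h_law : ∀ i, HasLaw (Y i) (SBL.modelLaw μ f β₀) P)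
    (h_indep : iIndepFun Y P) :
    ∃ βhat : (n : ℕ) → (Fin n → S) → EuclideanSpace ℝ (Fin (r + s)),
      (∀ n, Measurable (βhat n)) ∧ (∀ n y, βhat n y ∈ Θ) ∧
      Tendsto (fun n : ℕ => P {ω | ¬ IsLocalMinOn
          (SBL.penalizedLoss f p (n * τ₀) fun i : Fin n => Y i ω) Θ
          (βhat n fun i : Fin n => Y i ω)}) atTop (𝓝 0) ∧
      Tendsto (fun n : ℕ => P {ω | SBL.inactiveBlock (βhat n fun i : Fin n => Y i ω) ≠ 0})
        atTop (𝓝 0) ∧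
      TendstoInDistribution
        (fun (n : ℕ) (ω : Ω) => √(n : ℝ) •
          (SBL.activeBlock (βhat n fun i : Fin n => Y i ω) - SBL.activeBlock β₀))
        atTop id (fun _ => P)
        (multivariateGaussian 0 (SBL.activeFisherInfo μ f β₀)⁻¹) := by
  open SBL in
  obtain ⟨B, M, hB, hβB, hBΘ, hM, hM0, hreg⟩ := h_model.exists_ae_regularObservation
  -- The irregular observations need not form a measurable set, so they are enclosed in a measurable
  -- null set.
  obtain ⟨N, hNsub, hNm, hN0⟩ := exists_measurable_superset_of_null hreg
  have hGreg : ∀ y ∈ Nᶜ, RegularObservation f B M y := fun y hy => by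
    by_contra hcon
    exact hy (hNsub hcon)
  have hG : ∀ᵐ y ∂(modelLaw μ f β₀), y ∈ Nᶜ := measure_eq_zero_iff_ae_notMem.1 hN0
  set m₀ := ∫ y, M y ∂(modelLaw μ f β₀) + 1
  have hm₀ : 0 ≤ m₀ := add_nonneg (integral_nonneg hM0) zero_le_one
  have hpd : (activeFisherInfo μ f β₀).PosDef :=
    h_model.fisherInfo_posDef.submatrix (Fin.castAdd_injective r s)
  obtain ⟨δ, hδ, hsub, hne, hdet⟩ := exists_radius_local_minimizer (Θ := Θ) (f := f) (M := M)
    hB hβB h_active h_inactive h_model.fisherInfo_posDef h_prior hτ₀ hm₀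
  choose xhat hxm hxδ hxmin using fun n : ℕ =>
    h_model.exists_measurable_active_argmin h_inactive h_prior (τ := n * τ₀) (by positivity)
      hδ hsub hBΘ hne hNm.compl hGreg n
  -- with probability close to one, the estimator is a local minimizer close to the linear one
  have key : ∀ ε > 0, ∀ ε' : ENNReal, 0 < ε' → ∀ᶠ n : ℕ in atTop, P {ω | ¬
      (‖√(n : ℝ) • xhat n (fun i : Fin n => Y i ω) -
          Matrix.toEuclideanLin (activeFisherInfo μ f β₀)⁻¹
            (activeBlock (sampleScore f β₀ fun i : Fin n => Y i ω))‖ ≤ ε ∧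
        IsLocalMinOn (penalizedLoss f p (n * τ₀) fun i : Fin n => Y i ω) Θ
          (embedActive (activeBlock β₀ + xhat n fun i : Fin n => Y i ω)))} ≤ ε' := by
    intro ε hε ε' hε'
    obtain ⟨K, hK, hprob⟩ := h_model.exists_eventually_measure_not_regularSample_le h_law h_indep
      hM hG hGreg hε'
    obtain ⟨η, hη, hev⟩ := hdet K hK ε hε
    filter_upwards [hev, hprob η hη] with n hn hPn
    refine (measure_mono ?_).trans hPn
    intro ω hω hcon
    refine hω ?_
    exact hn _ hcon.2 _ _ (toEuclideanLin_mul_inv hpd _) (hxδ n _) (hxmin n _ hcon.1)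
  have hact : ∀ n y, activeBlock (embedActive (activeBlock β₀ + xhat n y) :
      EuclideanSpace ℝ (Fin (r + s))) - activeBlock β₀ = xhat n y := fun n y => by
    rw [activeBlock_embedActive, add_sub_cancel_left]
  refine ⟨fun n y => embedActive (activeBlock β₀ + xhat n y), fun n => ?_, fun n y => ?_, ?_, ?_,
    ?_⟩
  · exact continuous_embedActive.measurable.comp ((hxm n).const_add _)
  · refine hBΘ (hsub ?_)
    rw [mem_closedBall_iff_norm]
    conv_lhs => rw [← embedActive_activeBlock h_inactive]
    rw [activeBlock_embedActive, ← embedActive_sub, add_sub_cancel_left, norm_embedActive]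
    exact hxδ n y
  · refine ENNReal.tendsto_nhds_zero.2 fun ε' hε' => ?_
    filter_upwards [key 1 one_pos ε' hε'] with n hn
    refine (measure_mono ?_).trans hn
    intro ω hω hcon
    exact hω hcon.2
  -- The estimator lies on the face, so the event is empty.
  · simp
  · simp only [hact]
    -- Slutsky: `key` makes the difference from `I₁⁻¹ S_n` tend to zero in probability.
    refine tendstoInDistribution_of_tendstoInMeasure_sub _ _
      (h_model.tendstoInDistribution_inv_info_score h_law h_indep) ?_ fun n => ?_
    · rw [tendstoInMeasure_iff_norm]
      intro ε hε
      refine ENNReal.tendsto_nhds_zero.2 fun ε' hε' => ?_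
      filter_upwards [key (ε / 2) (half_pos hε) ε' hε'] with n hn
      refine (measure_mono ?_).trans hn
      intro ω hω hcon
      have h1 : ε ≤ ‖√(n : ℝ) • xhat n (fun i : Fin n => Y i ω) -
          Matrix.toEuclideanLin (activeFisherInfo μ f β₀)⁻¹
            (activeBlock (sampleScore f β₀ fun i : Fin n => Y i ω))‖ := by
        simpa using hω
      linarith [hcon.1]
    · have hY : AEMeasurable (fun ω => fun i : Fin n => Y i ω) P :=
        aemeasurable_pi_lambda _ fun i => (h_law i).aemeasurable
      exact (continuous_const_smul √(n : ℝ)).measurable.comp_aemeasurable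
        ((hxm n).comp_aemeasurable hY)
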